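/- Let $0<\mathfrak{n}_1<\mathfrak{n}_2$ and $s_-\in\mathbb{R}$, and let $\widehat{\mathbb{C}}=\mathbb{C}\cup\{\infty\}$ be the Riemann sphere. For $\kappa\in\mathbb{C}$ consider on $\widehat{\mathbb{C}}$ the control system $$x'(s)=\mathrm{i}\kappa\,(-x(s)^2+\varepsilon(s)),\qquad s\ge s_-,$$ where in the coordinate $\widetilde x=-1/x$ (in particular near $x=\infty$) the system reads $\widetilde x'=\mathrm{i}\kappa(-1+\varepsilon\,\widetilde x^2)$, and where the feasible controls are the measurable functions $\varepsilon:(s_-,+\infty)\to\mathbb{R}$ with $\mathfrak{n}_1^2\le\varepsilon(s)\le\mathfrak{n}_2^2$ for a.e. $s$; solutions are continuous $\widehat{\mathbb{C}}$-valued functions that satisfy these equations in the Carathéodory (integrated) sense. For $\eta\in\widehat{\mathbb{C}}$ and $t\ge 0$ let $\mathfrak{C}_{[0,t)}(\eta,\kappa)$ be the set of all $\xi\in\widehat{\mathbb{C}}$ for which there are $t_0\in[0,t)$ and a feasible control steering $x(s_-)=\xi$ to $x(s_-+t_0)=\eta$, and let $\mathfrak{R}_{[0,t)}(\eta,\kappa)$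 be the set of all $\xi$ with $\eta\in\mathfrak{C}_{[0,t)}(\xi,\kappa)$. For $r\ge 0$ put $\mathbb{D}_r(\eta)=\{x\in\mathbb{C}:|x-\eta|<r\}$ if $\eta\in\mathbb{C}$, and $\mathbb{D}_r(\infty)=\{x\in\widehat{\mathbb{C}}:|-1/x|<r\}$. For $\Omega\subset\mathbb{C}$, the system is called small-time locally controllable (STLC) to $\eta$ uniformly over $\Omega$ if there exist $\delta'>0$ and a strictly increasing continuous function $\rho:[0,\delta')\to[0,+\infty)$ such that $$\rho(t)\le\sup\{r\ge 0:\ \mathbb{D}_r(\eta)\subset\mathfrak{C}_{[0,t)}(\eta,\kappa)\}\qquad\text{for all }\kappa\in\Omega,\ t\in[0,\delta').$$ STLC from $\eta$ uniformly over $\Omega$ is defined in the same way with $\mathfrak{R}_{[0,t)}(\eta,\kappa)$ in place of $\mathfrak{C}_{[0,t)}(\eta,\kappa)$. **Theorem.** Let $\kappa_0\in\mathbb{C}\setminus\mathrm{i}\mathbb{R}$ and $\eta\in\widehat{\mathbb{C}}$. Then there exists $\delta>0$ such that the system is STLC to $\eta$ uniformly over the disc $\mathbb{D}_\delta(\kappa_0)=\{\kappa\in\mathbb{C}:|\kappa-\kappa_0|<\delta\}$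 if and only if $\eta\in(-\mathfrak{n}_2,-\mathfrak{n}_1)\cup(\mathfrak{n}_1,\mathfrak{n}_2)$. Likewise, there exists $\delta>0$ such that the system is STLC from $\eta$ uniformly over $\mathbb{D}_\delta(\kappa_0)$ if and only if $\eta\in(-\mathfrak{n}_2,-\mathfrak{n}_1)\cup(\mathfrak{n}_1,\mathfrak{n}_2)$. -/

import Mathlib

open MeasureTheory Set
open scoped NNReal ENNReal

namespace RiccatiControl

/-- The state space `ℂ ∪ {∞}`, with its usual (one-point compactification) topology. -/
abbrev Sphere : Type := OnePoint ℂ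

/-- The map `x ↦ -1/x` of the Riemann sphere, with `0 ↦ ∞` and `∞ ↦ 0`. -/
noncomputable def negInv : Sphere → Sphere
  | none => ((0 : ℂ) : Sphere)
  | some z => if z = 0 then OnePoint.infty else ((-1 / z : ℂ) : Sphere)

/-- The feasible controls on `(s₀, ∞)`: real-valued measurable functions with
`n₁² ≤ ε(s) ≤ n₂²` for almost every `s > s₀`. -/
def IsFeasible (n₁ n₂ s₀ : ℝ) (ε : ℝ → ℝ) : Prop :=
  AEMeasurable ε (volume.restrict (Ioi s₀)) ∧
    ∀ᵐ s ∂(volume.restrict (Ioi s₀)), n₁ ^ 2 ≤ ε s ∧ ε s ≤ n₂ ^ 2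

/-- `x : [s₀, s₁] → ℂ ∪ {∞}` is a (Carathéodory) solution of the control system with
spectral parameter `κ` and control `ε`: it is continuous,
* it solves `x' = iκ(-x² + ε)` on every interval on which it is finite, and
* `x̃ = -1/x` solves `x̃' = iκ(-1 + ε x̃²)` on every interval on which `x̃` is finite,
both equations being understood in integrated form. In the first item `z` is `x` read as a
complex-valued function on `[a, b]`, in the second one `w` is `-1/x` read in the same way;
both are then continuous on `[a, b]`, so for a feasible `ε` the integrands are bounded and
measurable there. -/
structure IsTrajectory (κ : ℂ) (ε : ℝ → ℝ) (s₀ s₁ : ℝ) (x : ℝ → Sphere) : Prop where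
  continuousOn : ContinuousOn x (Icc s₀ s₁)
  finite_chart : ∀ (a b : ℝ) (z : ℝ → ℂ), s₀ ≤ a → a ≤ b → b ≤ s₁ →
    (∀ s ∈ Icc a b, x s = (z s : Sphere)) →
      z b - z a = ∫ s in a..b, Complex.I * κ * (-(z s) ^ 2 + (ε s : ℂ))
  infinite_chart : ∀ (a b : ℝ) (w : ℝ → ℂ), s₀ ≤ a → a ≤ b → b ≤ s₁ →
    (∀ s ∈ Icc a b, negInv (x s) = (w s : Sphere)) →
      w b - w a = ∫ s in a..b, Complex.I * κ * (-1 + (ε s : ℂ) * (w s) ^ 2)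

/-- The states that some feasible control steers to `η` in time exactly `t`. -/
def controllableAt (n₁ n₂ s₀ : ℝ) (κ : ℂ) (η : Sphere) (t : ℝ) : Set Sphere :=
  {ξ | ∃ (ε : ℝ → ℝ) (x : ℝ → Sphere), IsFeasible n₁ n₂ s₀ ε ∧
    IsTrajectory κ ε s₀ (s₀ + t) x ∧ x s₀ = ξ ∧ x (s₀ + t) = η}

/-- The states controllable to `η` in some time `t₀ ∈ [0, t)`. -/
def controllableSet (n₁ n₂ s₀ : ℝ) (κ : ℂ) (η : Sphere) (t : ℝ) : Set Sphere :=
  ⋃ t₀ ∈ Ico 0 t, controllableAt n₁ n₂ s₀ κ η t₀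

/-- The states reachable from `η` in some time `t₀ ∈ [0, t)`. -/
def reachableSet (n₁ n₂ s₀ : ℝ) (κ : ℂ) (η : Sphere) (t : ℝ) : Set Sphere :=
  {ξ | η ∈ controllableSet n₁ n₂ s₀ κ ξ t}

/-- The open disc `{x ∈ ℂ : |x - η| < r}` around a finite `η`; around `η = ∞` it is the disc
`{x : |-1/x| < r}` in the coordinate `-1/x`. It is empty for `r = 0`. -/
noncomputable def disc (η : Sphere) (r : ℝ) : Set Sphere :=
  match η with
  | none => {ξ | ∃ w : ℂ, negInv ξ = (w : Sphere) ∧ ‖w‖ < r}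
  | some c => {ξ | ∃ z : ℂ, ξ = (z : Sphere) ∧ ‖z - c‖ < r}

/-- `sup {r ≥ 0 : disc η r ⊆ S}`, with values in `[0, ∞]`. -/
noncomputable def rMax (η : Sphere) (S : Set Sphere) : ℝ≥0∞ :=
  ⨆ (r : ℝ≥0) (_ : disc η (r : ℝ) ⊆ S), (r : ℝ≥0∞)

/-- Small-time local controllability to `η`, uniformly over the set `Ω` of spectral parameters:
there is a strictly increasing continuous `ρ : [0, δ) → [0, ∞)` bounding from below the radius
of the largest disc around `η` that is controllable to `η` in time less than `t`. -/
def UniformSTLCTo (n₁ n₂ s₀ : ℝ) (Ω : Set ℂ) (η : Sphere) : Prop :=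
  ∃ (δ : ℝ) (ρ : ℝ → ℝ≥0), 0 < δ ∧ ContinuousOn ρ (Ico 0 δ) ∧ StrictMonoOn ρ (Ico 0 δ) ∧
    ∀ κ ∈ Ω, ∀ t ∈ Ico 0 δ, (ρ t : ℝ≥0∞) ≤ rMax η (controllableSet n₁ n₂ s₀ κ η t)

/-- Small-time local controllability from `η`, uniformly over the set `Ω` of spectral
parameters: the same with reachable sets in place of controllable sets. -/
def UniformSTLCFrom (n₁ n₂ s₀ : ℝ) (Ω : Set ℂ) (η : Sphere) : Prop :=
  ∃ (δ : ℝ) (ρ : ℝ → ℝ≥0), 0 < δ ∧ ContinuousOn ρ (Ico 0 δ) ∧ StrictMonoOn ρ (Ico 0 δ) ∧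
    ∀ κ ∈ Ω, ∀ t ∈ Ico 0 δ, (ρ t : ℝ≥0∞) ≤ rMax η (reachableSet n₁ n₂ s₀ κ η t)

/-- The set `(-n₂, -n₁) ∪ (n₁, n₂)` of real points, as a subset of the sphere. -/
def regularEquilibria (n₁ n₂ : ℝ) : Set Sphere :=
  (fun c : ℝ => ((c : ℂ) : Sphere)) '' (Ioo (-n₂) (-n₁) ∪ Ioo n₁ n₂)

end RiccatiControl

namespace RiccatiControl

/-! Necessity. At a finite point `c` the velocity is `iκ(e - c²)` with `e ∈ [n₁², n₂²]`. Unless `c²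
∈ (n₁², n₂²)`, the segment of values `e - c²` lies in a cone `m‖u‖ ≤ Re(ωu)` with `m > 0`
(`exists_separating_direction`); at `∞`, in the chart `-1/x`, the velocity is `-iκ` for every
control. Over short times the state-dependent remainder is absorbed by the cone margin
(`re_nonneg_of_small_time`), so every trajectory with an end at the point has its displacement in a
closed half-plane. Half of each small disc is then unattainable, which already contradicts
controllability at `κ₀` itself.

Sufficiency. With `x = η + iκ(p + iq)` and `ε = η² + u`, the real control `u` enters only the
equation for `p'`, and `q'` is a quadratic expression in `p`. Its linear coefficient near `q = 0` is
close to `-2η Re κ`, nonzero because `κ₀` is not imaginary, so `p`, and then `u`, are functions of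
`q`, `q'`, `q''`: `q` is a flat output. Steering reduces to Hermite interpolation of `q`
(`exists_hermite`), and continuity at `(κ₀, 0, 0, 0)` makes the controls feasible uniformly in `κ`.
Time `T` reaches a disc of radius `cT²` (`exists_uniform_local_control`). -/

/-! ### Half-plane estimate for short times -/

/-- With `U = ∫‖u‖`, the zero of `y` forces `sup ‖y‖ ≤ 2‖k‖U`, so `∫ g` is at most `mU` in norm,
while `u` contributes at least `mU` in the direction `c`. Measuring everything against `U`, not
against a lower bound for `‖u‖`, admits controls for which `u` vanishes; this is what covers the
endpoints `±n₁`, `±n₂`. -/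
theorem re_nonneg_of_small_time {a b : ℝ} {k c : ℂ} {y u g : ℝ → ℂ} {m L : ℝ} (hab : a ≤ b)
    (hk : k ≠ 0) (hc : ‖c‖ = 1) (hL : 0 ≤ L) (hy : ContinuousOn y (Icc a b))
    (hu : IntervalIntegrable u volume a b) (hg : IntervalIntegrable g volume a b)
    (hint : ∀ s ∈ Icc a b, ∀ t ∈ Icc a b, s ≤ t → y t - y s = ∫ τ in s..t, k * (u τ + g τ))
    (hgL : ∀ s ∈ Icc a b, ‖g s‖ ≤ L * ‖y s‖)
    (hmu : ∀ s ∈ Icc a b, m * ‖u s‖ ≤ (c * u s).re)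
    {p : ℝ} (hp : p ∈ Icc a b) (hyp : y p = 0)
    (h1 : ‖k‖ * L * (b - a) ≤ 1 / 2) (h2 : 2 * ‖k‖ * L * (b - a) ≤ m) :
    0 ≤ (c * (y b - y a) / k).re := by
  have hk' : 0 < ‖k‖ := norm_pos_iff.2 hk
  obtain ⟨q, hq, hqmax⟩ := isCompact_Icc.exists_isMaxOn (nonempty_Icc.2 hab) hy.norm
  have hmax : ∀ s ∈ Icc a b, ‖y s‖ ≤ ‖y q‖ := fun s hs => hqmax hs
  set M := ‖y q‖ with hM
  set U := ∫ s in a..b, ‖u s‖ with hU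
  have hU0 : 0 ≤ U := intervalIntegral.integral_nonneg hab fun s _ => norm_nonneg _
  have hsub : ∀ s ∈ Icc a b, ∀ t ∈ Icc a b, s ≤ t → uIcc s t ⊆ uIcc a b := by
    intro s hs t ht hst
    rw [uIcc_of_le hst, uIcc_of_le hab]
    exact Icc_subset_Icc hs.1 ht.2
  have key : ∀ s ∈ Icc a b, ∀ t ∈ Icc a b, s ≤ t →
      ‖y t - y s‖ ≤ ‖k‖ * (U + L * M * (b - a)) := by
    intro s hs t ht hst
    rw [hint s hs t ht hst, intervalIntegral.integral_const_mul, norm_mul]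
    refine mul_le_mul_of_nonneg_left ?_ hk'.le
    have hu' := hu.mono_set (hsub s hs t ht hst)
    have hg' := hg.mono_set (hsub s hs t ht hst)
    rw [intervalIntegral.integral_add hu' hg']
    refine (norm_add_le _ _).trans (add_le_add ?_ ?_)
    · refine (intervalIntegral.norm_integral_le_integral_norm hst).trans ?_
      exact intervalIntegral.integral_mono_interval hs.1 hst ht.2
        (Filter.Eventually.of_forall fun _ => norm_nonneg _) hu.norm
    · have : ‖∫ τ in s..t, g τ‖ ≤ (L * M) * |t - s| := by
        refine intervalIntegral.norm_integral_le_of_norm_le_const fun τ hτ => ?_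
        rw [uIoc_of_le hst] at hτ
        have hτ' : τ ∈ Icc a b := ⟨hs.1.trans hτ.1.le, hτ.2.trans ht.2⟩
        exact (hgL τ hτ').trans (mul_le_mul_of_nonneg_left (hmax τ hτ') hL)
      refine this.trans (mul_le_mul_of_nonneg_left ?_ (by positivity))
      rw [abs_of_nonneg (by linarith)]
      linarith [hs.1, ht.2]
  have hMle : M ≤ ‖k‖ * (U + L * M * (b - a)) := by
    rcases le_total p q with h | h
    · simpa [hyp] using key p hp q hq h
    · simpa [hyp] using key q hq p hp h
  have hM2 : M ≤ 2 * ‖k‖ * U := by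
    have : ‖k‖ * L * (b - a) * M ≤ 1 / 2 * M :=
      mul_le_mul_of_nonneg_right h1 (norm_nonneg _)
    nlinarith
  have ha : a ∈ Icc a b := ⟨le_rfl, hab⟩
  have hb : b ∈ Icc a b := ⟨hab, le_rfl⟩
  have e1 : c * (y b - y a) / k = (∫ s in a..b, c * u s) + c * ∫ s in a..b, g s := by
    rw [hint a ha b hb hab, intervalIntegral.integral_const_mul,
      intervalIntegral.integral_add hu hg, intervalIntegral.integral_const_mul]
    field_simp
  have e2 : (∫ s in a..b, c * u s).re = ∫ s in a..b, (c * u s).re := by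
    have := Complex.reCLM.intervalIntegral_comp_comm (hu.const_mul c)
    simpa using this.symm
  have e3 : m * U ≤ ∫ s in a..b, (c * u s).re := by
    rw [hU, ← intervalIntegral.integral_const_mul]
    refine intervalIntegral.integral_mono_on hab (hu.norm.const_mul m) ?_ hmu
    have := (hu.const_mul c)
    exact ⟨this.1.re, this.2.re⟩
  have e4 : ‖c * ∫ s in a..b, g s‖ ≤ L * M * (b - a) := by
    rw [norm_mul, hc, one_mul]
    have : ‖∫ τ in a..b, g τ‖ ≤ (L * M) * |b - a| := by
      refine intervalIntegral.norm_integral_le_of_norm_le_const fun τ hτ => ?_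
      rw [uIoc_of_le hab] at hτ
      have hτ' : τ ∈ Icc a b := ⟨hτ.1.le, hτ.2⟩
      exact (hgL τ hτ').trans (mul_le_mul_of_nonneg_left (hmax τ hτ') hL)
    rwa [abs_of_nonneg (by linarith)] at this
  have e5 : -(L * M * (b - a)) ≤ (c * ∫ s in a..b, g s).re := by
    have := Complex.abs_re_le_norm (c * ∫ s in a..b, g s)
    linarith [neg_abs_le (c * ∫ s in a..b, g s).re]
  rw [e1, Complex.add_re, e2]
  have e6 : L * (b - a) * M ≤ L * (b - a) * (2 * ‖k‖ * U) :=
    mul_le_mul_of_nonneg_left hM2 (mul_nonneg hL (by linarith))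
  have e7 : 2 * ‖k‖ * L * (b - a) * U ≤ m * U := mul_le_mul_of_nonneg_right h2 hU0
  nlinarith

/-- A continuous function starting below `r` stays below `r` if it cannot reach the level `r`
along an initial interval on which it is at most `r`. -/
theorem lt_of_barrier_right {a b r : ℝ} {f : ℝ → ℝ} (hf : ContinuousOn f (Icc a b))
    (ha : f a < r)
    (h : ∀ t ∈ Icc a b, (∀ s ∈ Icc a t, f s ≤ r) → f t < r) : ∀ s ∈ Icc a b, f s < r := by
  intro s hs
  by_contra! hsr
  have ivt : ∀ t ∈ Icc a b, r ≤ f t → ∃ τ ∈ Icc a t, f τ = r := fun t ht htr =>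
    intermediate_value_Icc ht.1 (hf.mono (Icc_subset_Icc le_rfl ht.2)) ⟨ha.le, htr⟩
  have hcl : IsCompact (Icc a b ∩ f ⁻¹' {r}) :=
    isCompact_Icc.of_isClosed_subset (hf.preimage_isClosed_of_isClosed isClosed_Icc
      isClosed_singleton) inter_subset_left
  obtain ⟨τ, hτ, hτr⟩ := ivt s hs hsr
  obtain ⟨t, ht, htmin⟩ := hcl.exists_isLeast ⟨τ, ⟨hτ.1, hτ.2.trans hs.2⟩, hτr⟩
  refine (h t ht.1 fun σ hσ => ?_).ne ht.2
  by_contra! hσr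
  have hσb : σ ∈ Icc a b := ⟨hσ.1, hσ.2.trans ht.1.2⟩
  obtain ⟨ω, hω, hωr⟩ := ivt σ hσb hσr.le
  have h1 : t ≤ ω := htmin ⟨⟨hω.1, hω.2.trans hσb.2⟩, hωr⟩
  have h2 : σ = t := le_antisymm hσ.2 (h1.trans hω.2)
  rw [h2] at hσr
  exact hσr.ne' ht.2

theorem lt_of_barrier_left {a b r : ℝ} {f : ℝ → ℝ} (hf : ContinuousOn f (Icc a b))
    (hb : f b < r)
    (h : ∀ t ∈ Icc a b, (∀ s ∈ Icc t b, f s ≤ r) → f t < r) : ∀ s ∈ Icc a b, f s < r := by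
  have hneg : ∀ s, s ∈ Icc (-b) (-a) → -s ∈ Icc a b := fun s hs =>
    ⟨by linarith [hs.2], by linarith [hs.1]⟩
  have := lt_of_barrier_right (a := -b) (b := -a) (r := r) (f := fun s => f (-s))
    (hf.comp continuousOn_neg fun s hs => hneg s hs) (by simpa using hb)
    (fun t ht hs => h (-t) (hneg t ht) fun s hs' => by
      simpa using hs (-s) ⟨by linarith [hs'.2], by linarith [hs'.1]⟩)
  intro s hs
  simpa using this (-s) ⟨by linarith [hs.2], by linarith [hs.1]⟩

/-! ### Charts of the sphere and lifting of short trajectories -/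

/-- The distance to `c`, truncated at `1`. -/
noncomputable def truncDist (c : ℂ) : Sphere → ℝ
  | none => 1
  | some z => min ‖z - c‖ 1

theorem truncDist_coe (c z : ℂ) : truncDist c (z : Sphere) = min ‖z - c‖ 1 := rfl

theorem truncDist_infty (c : ℂ) : truncDist c OnePoint.infty = 1 := rfl

theorem continuous_truncDist (c : ℂ) : Continuous (truncDist c) := by
  rw [OnePoint.continuous_iff]
  constructor
  · rw [Filter.coclosedCompact_eq_cocompact]
    refine tendsto_const_nhds.congr' ?_
    have h : Filter.Tendsto (fun z : ℂ => ‖z - c‖) (Filter.cocompact ℂ) Filter.atTop := by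
      refine Filter.tendsto_atTop_mono (fun z => ?_)
        (Filter.tendsto_atTop_add_const_right _ (-‖c‖) (tendsto_norm_cocompact_atTop (E := ℂ)))
      simpa [sub_eq_add_neg] using norm_sub_norm_le z c
    filter_upwards [h.eventually_ge_atTop 1] with z hz
    rw [truncDist_infty, truncDist_coe, min_eq_right hz]
  · simp only [truncDist_coe]
    fun_prop

theorem exists_coe_of_truncDist_lt {c : ℂ} {r : ℝ} (hr : r ≤ 1) {ξ : Sphere}
    (h : truncDist c ξ < r) : ∃ z : ℂ, ξ = z ∧ ‖z - c‖ < r := by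
  induction ξ using OnePoint.rec with
  | infty => rw [truncDist_infty] at h; linarith
  | coe z =>
    rw [truncDist_coe] at h
    exact ⟨z, rfl, (min_lt_iff.1 h).resolve_right (by linarith)⟩

theorem negInv_infty : negInv OnePoint.infty = ((0 : ℂ) : Sphere) := rfl

theorem negInv_coe (z : ℂ) : negInv (z : Sphere) =
    if z = 0 then OnePoint.infty else ((-1 / z : ℂ) : Sphere) := rfl

theorem negInv_negInv (ξ : Sphere) : negInv (negInv ξ) = ξ := by
  induction ξ using OnePoint.rec with
  | infty => simp [negInv_infty, negInv_coe]
  | coe z =>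
    rw [negInv_coe]
    split_ifs with h
    · simp [negInv_infty, h]
    · simp [negInv_coe, h]

theorem continuous_negInv : Continuous negInv := by
  rw [OnePoint.continuous_iff]
  constructor
  · rw [Filter.coclosedCompact_eq_cocompact, negInv_infty]
    have h : Filter.Tendsto (fun z : ℂ => ((-1 / z : ℂ) : Sphere)) (Filter.cocompact ℂ)
        (nhds ((0 : ℂ) : Sphere)) := by
      refine (OnePoint.continuous_coe.tendsto _).comp ?_
      have := (Filter.tendsto_inv₀_cobounded (α := ℂ)).neg
      rw [neg_zero, Metric.cobounded_eq_cocompact] at this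
      refine this.congr fun z => ?_
      simp [div_eq_mul_inv]
    refine h.congr' ?_
    have hne : ∀ᶠ z : ℂ in Filter.cocompact ℂ, z ≠ 0 := by
      filter_upwards [(tendsto_norm_cocompact_atTop (E := ℂ)).eventually_gt_atTop 0] with z hz
      exact norm_pos_iff.1 hz
    filter_upwards [hne] with z hz
    rw [negInv_coe, if_neg hz]
  · rw [continuous_iff_continuousAt]
    intro z
    by_cases hz : z = 0
    · subst hz
      rw [continuousAt_iff_punctured_nhds]
      have h0 : negInv ((0 : ℂ) : Sphere) = OnePoint.infty := by simp [negInv_coe]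
      rw [h0]
      have h1 : Filter.Tendsto (fun z : ℂ => (-1 / z : ℂ)) (nhdsWithin 0 {0}ᶜ)
          (Filter.cocompact ℂ) := by
        rw [← Metric.cobounded_eq_cocompact]
        have := Filter.tendsto_neg_cobounded.comp (Filter.tendsto_inv₀_nhdsNE_zero (α := ℂ))
        refine this.congr fun z => ?_
        simp [div_eq_mul_inv]
      have h2 := OnePoint.tendsto_coe_infty (X := ℂ)
      rw [Filter.coclosedCompact_eq_cocompact] at h2
      refine (h2.comp h1).congr' ?_
      filter_upwards [self_mem_nhdsWithin] with w hw
      simp only [Function.comp]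
      rw [negInv_coe, if_neg (by simpa using hw)]
    · have h1 : ContinuousAt (fun z : ℂ => ((-1 / z : ℂ) : Sphere)) z :=
        OnePoint.continuous_coe.continuousAt.comp
          (continuousAt_const.div continuousAt_id hz)
      refine h1.congr ?_
      filter_upwards [isOpen_ne.mem_nhds hz] with w hw
      rw [negInv_coe, if_neg hw]

/-- While the truncated distance to `c` is at most `1/2`, the path is finite and its speed is at
most `‖k‖C`; the time is too short to cover the distance `1/2`, so that level is never reached. The
path therefore stays in one chart. -/
theorem exists_lift_of_short_time {a b : ℝ} {X : ℝ → Sphere} {k c : ℂ} {R : ℝ → ℂ → ℂ} {C : ℝ}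
    (hX : ContinuousOn X (Icc a b))
    (hint : ∀ (a' b' : ℝ) (z : ℝ → ℂ), a ≤ a' → a' ≤ b' → b' ≤ b →
      (∀ s ∈ Icc a' b', X s = (z s : Sphere)) → z b' - z a' = ∫ s in a'..b', k * R s (z s))
    (hR : ∀ s z, ‖z - c‖ ≤ 1 → ‖R s z‖ ≤ C) (hC : 0 ≤ C) (hsmall : ‖k‖ * C * (b - a) < 1 / 2)
    (hend : X a = (c : Sphere) ∨ X b = (c : Sphere)) :
    ∃ z : ℝ → ℂ, ∀ s ∈ Icc a b, X s = (z s : Sphere) ∧ ‖z s - c‖ < 1 / 2 := by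
  have hf : ContinuousOn (fun s => truncDist c (X s)) (Icc a b) :=
    (continuous_truncDist c).comp_continuousOn hX
  have hc : truncDist c (c : Sphere) = 0 := by simp [truncDist_coe]
  have step : ∀ a' b', a ≤ a' → a' ≤ b' → b' ≤ b →
      (∀ s ∈ Icc a' b', truncDist c (X s) ≤ 1 / 2) →
      ∃ z : ℝ → ℂ, (∀ s ∈ Icc a' b', X s = (z s : Sphere)) ∧ ‖z b' - z a'‖ < 1 / 2 := by
    intro a' b' ha hab hb h
    have h' : ∀ s, ∃ z : ℂ, s ∈ Icc a' b' → X s = z ∧ ‖z - c‖ < 1 := fun s => by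
      by_cases hs : s ∈ Icc a' b'
      · obtain ⟨z, hz⟩ := exists_coe_of_truncDist_lt le_rfl ((h s hs).trans_lt (by norm_num))
        exact ⟨z, fun _ => hz⟩
      · exact ⟨0, fun hs' => absurd hs' hs⟩
    choose z hz using h'
    refine ⟨z, fun s hs => (hz s hs).1, ?_⟩
    rw [hint a' b' z ha hab hb fun s hs => (hz s hs).1]
    have : ‖∫ s in a'..b', k * R s (z s)‖ ≤ (‖k‖ * C) * |b' - a'| := by
      refine intervalIntegral.norm_integral_le_of_norm_le_const fun s hs => ?_
      rw [uIoc_of_le hab] at hs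
      rw [norm_mul]
      exact mul_le_mul_of_nonneg_left (hR s _ (hz s ⟨hs.1.le, hs.2⟩).2.le) (norm_nonneg _)
    rw [abs_of_nonneg (by linarith)] at this
    have h2 : ‖k‖ * C * (b' - a') ≤ ‖k‖ * C * (b - a) :=
      mul_le_mul_of_nonneg_left (by linarith) (by positivity)
    linarith
  have main : ∀ s ∈ Icc a b, truncDist c (X s) < 1 / 2 := by
    rcases hend with h0 | h0
    · refine lt_of_barrier_right hf (by rw [h0, hc]; norm_num) fun t ht h => ?_
      obtain ⟨z, hz, hlt⟩ := step a t le_rfl ht.1 ht.2 h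
      have h1 := hz a ⟨le_rfl, ht.1⟩
      rw [h0, OnePoint.coe_eq_coe] at h1
      rw [hz t ⟨ht.1, le_rfl⟩, truncDist_coe, h1]
      exact (min_le_left _ _).trans_lt hlt
    · refine lt_of_barrier_left hf (by rw [h0, hc]; norm_num) fun t ht h => ?_
      obtain ⟨z, hz, hlt⟩ := step t b ht.1 ht.2 le_rfl h
      have h1 := hz b ⟨ht.2, le_rfl⟩
      rw [h0, OnePoint.coe_eq_coe] at h1
      rw [hz t ⟨le_rfl, ht.2⟩, truncDist_coe, h1, norm_sub_rev]
      exact (min_le_left _ _).trans_lt hlt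
  have h' : ∀ s, ∃ z : ℂ, s ∈ Icc a b → X s = z ∧ ‖z - c‖ < 1 / 2 := fun s => by
    by_cases hs : s ∈ Icc a b
    · obtain ⟨z, hz⟩ := exists_coe_of_truncDist_lt (by norm_num) (main s hs)
      exact ⟨z, fun _ => hz⟩
    · exact ⟨0, fun hs' => absurd hs' hs⟩
  choose z hz using h'
  exact ⟨z, hz⟩

theorem exists_small_time {k : ℂ} {m L C : ℝ} (hm : 0 < m) :
    ∃ τ : ℝ, 0 < τ ∧ ∀ t ∈ Ico 0 τ,
      ‖k‖ * C * t < 1 / 2 ∧ ‖k‖ * L * t ≤ 1 / 2 ∧ 2 * ‖k‖ * L * t ≤ m := by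
  have h : ∀ (A B : ℝ), 0 < B → ∀ᶠ t : ℝ in nhds 0, A * t < B := fun A B hB => by
    have : Continuous fun t : ℝ => A * t := by fun_prop
    exact (this.tendsto' 0 0 (by simp)).eventually_lt_const hB
  obtain ⟨τ, hτ, hτ'⟩ := Metric.eventually_nhds_iff.1
    ((h (‖k‖ * C) (1 / 2) (by norm_num)).and
      ((h (‖k‖ * L) (1 / 2) (by norm_num)).and (h (2 * ‖k‖ * L) m hm)))
  refine ⟨τ, hτ, fun t ht => ?_⟩
  obtain ⟨h1, h2, h3⟩ := @hτ' t (by simpa [abs_of_nonneg ht.1] using ht.2)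
  exact ⟨h1, h2.le, h3.le⟩

/-- A controlled equation `z' = k (u + G(s, z))` with `G(s, c) = 0` and with `u` in a proper cone
moves away from `c` in a half-plane. -/
theorem exists_lift_re_nonneg {a b : ℝ} {X : ℝ → Sphere} {k c ω : ℂ} {u : ℝ → ℂ}
    {G : ℝ → ℂ → ℂ} {m L C : ℝ} (hab : a ≤ b) (hk : k ≠ 0) (hω : ‖ω‖ = 1) (hL : 0 ≤ L)
    (hX : ContinuousOn X (Icc a b))
    (hint : ∀ (a' b' : ℝ) (z : ℝ → ℂ), a ≤ a' → a' ≤ b' → b' ≤ b →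
      (∀ s ∈ Icc a' b', X s = (z s : Sphere)) →
        z b' - z a' = ∫ s in a'..b', k * (u s + G s (z s)))
    (hu : IntervalIntegrable u volume a b)
    (hG : ∀ z : ℝ → ℂ, ContinuousOn z (Icc a b) →
      IntervalIntegrable (fun s => G s (z s)) volume a b)
    (hGL : ∀ s z, ‖z - c‖ ≤ 1 → ‖G s z‖ ≤ L * ‖z - c‖) (huC : ∀ s, ‖u s‖ ≤ C)
    (hmu : ∀ s, m * ‖u s‖ ≤ (ω * u s).re)
    (hend : X a = (c : Sphere) ∨ X b = (c : Sphere))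
    (h0 : ‖k‖ * (C + L) * (b - a) < 1 / 2)
    (h1 : ‖k‖ * L * (b - a) ≤ 1 / 2) (h2 : 2 * ‖k‖ * L * (b - a) ≤ m) :
    ∃ za zb : ℂ, X a = za ∧ X b = zb ∧ 0 ≤ (ω * (zb - za) / k).re := by
  have hC : 0 ≤ C := (norm_nonneg _).trans (huC a)
  obtain ⟨z, hz⟩ := exists_lift_of_short_time (R := fun s z => u s + G s z) (C := C + L) hX hint
    (fun s z hz => (norm_add_le _ _).trans (add_le_add (huC s)
      ((hGL s z hz).trans (mul_le_of_le_one_right hL hz)))) (by positivity) h0 hend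
  have ha : a ∈ Icc a b := ⟨le_rfl, hab⟩
  have hb : b ∈ Icc a b := ⟨hab, le_rfl⟩
  have hzc : ContinuousOn z (Icc a b) := by
    have : ContinuousOn ((↑) ∘ z : ℝ → Sphere) (Icc a b) :=
      hX.congr fun s hs => ((hz s hs).1).symm
    exact (OnePoint.isOpenEmbedding_coe.toIsInducing.continuousOn_iff).2 this
  refine ⟨z a, z b, (hz a ha).1, (hz b hb).1, ?_⟩
  obtain ⟨p, hp, hpc⟩ : ∃ p ∈ Icc a b, z p - c = 0 := by
    rcases hend with h | h
    · refine ⟨a, ha, ?_⟩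
      rw [(hz a ha).1, OnePoint.coe_eq_coe] at h
      rw [h, sub_self]
    · refine ⟨b, hb, ?_⟩
      rw [(hz b hb).1, OnePoint.coe_eq_coe] at h
      rw [h, sub_self]
  have := re_nonneg_of_small_time (y := fun s => z s - c) (u := u) (g := fun s => G s (z s))
    (m := m) hab hk hω hL (hzc.sub continuousOn_const) hu (hG z hzc)
    (fun s hs t ht hst => by
      have := hint s t z hs.1 hst ht.2 fun τ hτ => (hz τ ⟨hs.1.trans hτ.1, hτ.2.trans ht.2⟩).1
      rw [← this]; ring)
    (fun s hs => hGL s _ ((hz s hs).2.le.trans (by norm_num))) (fun s _ => hmu s) hp hpc h1 h2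
  simpa using this

/-! ### Local barriers at finite points and at infinity -/

theorem IsTrajectory.congr_ae {κ : ℂ} {ε ε' : ℝ → ℝ} {s₀ s₁ : ℝ} {x : ℝ → Sphere}
    (h : IsTrajectory κ ε s₀ s₁ x) (hε : ε =ᵐ[volume.restrict (Ioi s₀)] ε') :
    IsTrajectory κ ε' s₀ s₁ x := by
  have hae : ∀ a b : ℝ, s₀ ≤ a → a ≤ b → ∀ᵐ s ∂volume, s ∈ uIoc a b → ε s = ε' s := by
    intro a b ha hab
    filter_upwards [(ae_restrict_iff' measurableSet_Ioi).1 hε] with s hs hs'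
    rw [uIoc_of_le hab] at hs'
    exact hs (ha.trans_lt hs'.1)
  refine ⟨h.continuousOn, fun a b z ha hab hb hz => ?_, fun a b w ha hab hb hw => ?_⟩
  · rw [h.finite_chart a b z ha hab hb hz]
    refine intervalIntegral.integral_congr_ae ?_
    filter_upwards [hae a b ha hab] with s hs hs'
    rw [hs hs']
  · rw [h.infinite_chart a b w ha hab hb hw]
    refine intervalIntegral.integral_congr_ae ?_
    filter_upwards [hae a b ha hab] with s hs hs'
    rw [hs hs']

/-- Clamping a measurable representative turns the almost-everywhere bounds into the pointwise ones
that the half-plane estimate uses. -/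
theorem IsFeasible.exists_measurable {n₁ n₂ s₀ : ℝ} {ε : ℝ → ℝ} (hn : n₁ ^ 2 ≤ n₂ ^ 2)
    (h : IsFeasible n₁ n₂ s₀ ε) : ∃ ε' : ℝ → ℝ, Measurable ε' ∧
      (∀ s, n₁ ^ 2 ≤ ε' s ∧ ε' s ≤ n₂ ^ 2) ∧ ε =ᵐ[volume.restrict (Ioi s₀)] ε' := by
  refine ⟨fun s => max (n₁ ^ 2) (min (n₂ ^ 2) (h.1.mk ε s)),
    measurable_const.max (measurable_const.min h.1.measurable_mk),
    fun s => ⟨le_max_left _ _, max_le hn (min_le_left _ _)⟩, ?_⟩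
  filter_upwards [h.1.ae_eq_mk, h.2] with s hs hs'
  rw [← hs, min_eq_right hs'.2, max_eq_right hs'.1]

theorem intervalIntegrable_of_measurable_of_bound {ε : ℝ → ℝ} {C a b : ℝ} (hε : Measurable ε)
    (hC : ∀ s, |ε s| ≤ C) : IntervalIntegrable (fun s => (ε s : ℂ)) volume a b := by
  rw [intervalIntegrable_iff]
  exact Measure.integrableOn_of_bounded (M := C) (by simp)
    (Complex.measurable_ofReal.comp hε).aestronglyMeasurable
    (Filter.Eventually.of_forall fun s => by simpa using hC s)

/-- In the chart `J`, short trajectories that start or end at `η` move in a fixed half-plane, so that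
no state of an open half-disc around `η` can be steered to `η`, and none of another be reached
from `η` in short time. -/
def HasLocalBarrier (n₁ n₂ s₀ : ℝ) (κ : ℂ) (η : Sphere) (J : Sphere → Sphere) (ω : ℂ) : Prop :=
  ∃ τ : ℝ, 0 < τ ∧ ∀ t ∈ Ico 0 τ, ∀ (ε : ℝ → ℝ) (x : ℝ → Sphere), IsFeasible n₁ n₂ s₀ ε →
    IsTrajectory κ ε s₀ (s₀ + t) x → (x s₀ = η ∨ x (s₀ + t) = η) →
      ∃ za zb : ℂ, J (x s₀) = za ∧ J (x (s₀ + t)) = zb ∧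
        0 ≤ (ω * (zb - za) / (Complex.I * κ)).re

theorem hasLocalBarrier_coe {n₁ n₂ s₀ : ℝ} (hn : n₁ ^ 2 ≤ n₂ ^ 2) {κ : ℂ} (hκ : κ ≠ 0) {c ω : ℂ}
    {m : ℝ} (hm : 0 < m) (hω : ‖ω‖ = 1)
    (h : ∀ e : ℝ, n₁ ^ 2 ≤ e → e ≤ n₂ ^ 2 → m * ‖(e : ℂ) - c ^ 2‖ ≤ (ω * (e - c ^ 2)).re) :
    HasLocalBarrier n₁ n₂ s₀ κ (c : Sphere) id ω := by
  obtain ⟨τ, hτ, hτ'⟩ := exists_small_time (k := Complex.I * κ) (m := m) (L := 2 * ‖c‖ + 1)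
    (C := n₂ ^ 2 + ‖c‖ ^ 2 + (2 * ‖c‖ + 1)) hm
  refine ⟨τ, hτ, fun t ht ε x hε hx hend => ?_⟩
  obtain ⟨ε', hmeas, hbd, hae⟩ := hε.exists_measurable hn
  have hx' := hx.congr_ae hae
  obtain ⟨h0, h1, h2⟩ := hτ' t ht
  have habs : ∀ s, |ε' s| ≤ n₂ ^ 2 := fun s =>
    abs_le.2 ⟨by nlinarith [(hbd s).1, sq_nonneg n₁, sq_nonneg n₂], (hbd s).2⟩
  -- The splitting is `-z² + ε = (ε - c²) - (z - c)(2c + (z - c))`; on the unit disc around `c` the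
  -- last factor is at most `2‖c‖ + 1`.
  refine exists_lift_re_nonneg (u := fun s => (ε' s : ℂ) - c ^ 2)
    (G := fun _ z => -(z - c) * (2 * c + (z - c))) (L := 2 * ‖c‖ + 1) (m := m)
    (C := n₂ ^ 2 + ‖c‖ ^ 2) (by linarith [ht.1]) (by simp [hκ]) hω (by positivity)
    hx'.continuousOn ?_ ?_ ?_ ?_ ?_ (fun s => h _ (hbd s).1 (hbd s).2) hend ?_ ?_ ?_
  · intro a b z ha hab hb hz
    rw [hx'.finite_chart a b z ha hab hb hz]
    congr 1
    ext s
    ring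
  · exact (intervalIntegrable_of_measurable_of_bound hmeas habs).sub
      intervalIntegrable_const
  · intro z hz
    refine ContinuousOn.intervalIntegrable ?_
    rw [uIcc_of_le (by linarith [ht.1])]
    fun_prop
  · intro s z hz
    rw [norm_mul, norm_neg, mul_comm]
    refine mul_le_mul_of_nonneg_right ((norm_add_le _ _).trans ?_) (norm_nonneg _)
    rw [norm_mul, Complex.norm_ofNat]
    linarith
  · intro s
    refine (norm_sub_le _ _).trans (add_le_add ?_ (by simp))
    simpa using habs s
  all_goals rwa [add_sub_cancel_left]

theorem hasLocalBarrier_infty {n₁ n₂ s₀ : ℝ} (hn : n₁ ^ 2 ≤ n₂ ^ 2) {κ : ℂ} (hκ : κ ≠ 0) :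
    HasLocalBarrier n₁ n₂ s₀ κ OnePoint.infty negInv (-1) := by
  obtain ⟨τ, hτ, hτ'⟩ := exists_small_time (k := Complex.I * κ) (m := 1) (L := n₂ ^ 2)
    (C := 1 + n₂ ^ 2) one_pos
  refine ⟨τ, hτ, fun t ht ε x hε hx hend => ?_⟩
  obtain ⟨ε', hmeas, hbd, hae⟩ := hε.exists_measurable hn
  have hx' := hx.congr_ae hae
  obtain ⟨h0, h1, h2⟩ := hτ' t ht
  have habs : ∀ s, |ε' s| ≤ n₂ ^ 2 := fun s =>
    abs_le.2 ⟨by nlinarith [(hbd s).1, sq_nonneg n₁, sq_nonneg n₂], (hbd s).2⟩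
  have hle : s₀ ≤ s₀ + t := by linarith [ht.1]
  refine exists_lift_re_nonneg (X := fun s => negInv (x s)) (u := fun _ => -1) (c := 0)
    (G := fun s z => (ε' s : ℂ) * z ^ 2) (L := n₂ ^ 2) (m := 1)
    (C := 1) hle (by simp [hκ]) (by simp) (by positivity)
    (continuous_negInv.comp_continuousOn hx'.continuousOn) hx'.infinite_chart
    intervalIntegrable_const ?_ ?_ (by simp) (by simp)
    (hend.imp (fun h => by simp [h, negInv_infty]) (fun h => by simp [h, negInv_infty])) ?_ ?_ ?_
  · intro z hz
    refine (intervalIntegrable_of_measurable_of_bound hmeas habs).mul_continuousOn ?_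
    rw [uIcc_of_le hle]
    exact hz.pow 2
  · intro s z hz
    rw [sub_zero] at hz ⊢
    rw [norm_mul, norm_pow]
    have h3 : ‖(ε' s : ℂ)‖ ≤ n₂ ^ 2 := by simpa using habs s
    nlinarith [norm_nonneg z, norm_nonneg (ε' s : ℂ), mul_le_mul_of_nonneg_left hz (norm_nonneg z),
      mul_le_mul_of_nonneg_right h3 (sq_nonneg ‖z‖), sq_nonneg n₂]
  all_goals rwa [add_sub_cancel_left]

/-! ### A barrier excludes local controllability -/

theorem exists_disc_subset_of_le_rMax {η : Sphere} {S : Set Sphere} {ρ : ℝ≥0} (hρ : 0 < ρ)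
    (h : (ρ : ℝ≥0∞) ≤ rMax η S) : ∃ r : ℝ, 0 < r ∧ disc η r ⊆ S := by
  have h0 : 0 < rMax η S := lt_of_lt_of_le (by exact_mod_cast hρ) h
  simp only [rMax, lt_iSup_iff] at h0
  obtain ⟨r, hr, hr0⟩ := h0
  exact ⟨r, by exact_mod_cast hr0, hr⟩

theorem exists_time_exists_disc_subset {δ τ : ℝ} {ρ : ℝ → ℝ≥0} {η : Sphere} {S : ℝ → Set Sphere}
    (hδ : 0 < δ) (hτ : 0 < τ) (hρ : StrictMonoOn ρ (Ico 0 δ))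
    (h : ∀ t ∈ Ico 0 δ, (ρ t : ℝ≥0∞) ≤ rMax η (S t)) :
    ∃ t ∈ Ico 0 τ, ∃ r : ℝ, 0 < r ∧ disc η r ⊆ S t := by
  have h1 : 0 < min δ τ := lt_min hδ hτ
  have ht : min δ τ / 2 ∈ Ico 0 δ := ⟨by positivity, by linarith [min_le_left δ τ]⟩
  exact ⟨min δ τ / 2, ⟨by positivity, by linarith [min_le_right δ τ]⟩,
    exists_disc_subset_of_le_rMax
      (pos_of_gt (hρ ⟨le_rfl, hδ⟩ ht (by positivity))) (h _ ht)⟩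

theorem not_uniformSTLC_of_barrier {n₁ n₂ s₀ : ℝ} {κ : ℂ} {η : Sphere} {J : Sphere → Sphere}
    {ω c : ℂ} (hκ : κ ≠ 0) (hω : ω ≠ 0) (hJ : ∀ ξ, J (J ξ) = ξ) (hJη : J η = (c : Sphere))
    (hdisc : ∀ r, disc η r = {ξ | ∃ w : ℂ, J ξ = (w : Sphere) ∧ ‖w - c‖ < r})
    (hB : HasLocalBarrier n₁ n₂ s₀ κ η J ω) {Ω : Set ℂ} (hΩ : κ ∈ Ω) :
    ¬ UniformSTLCTo n₁ n₂ s₀ Ω η ∧ ¬ UniformSTLCFrom n₁ n₂ s₀ Ω η := by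
  obtain ⟨τ, hτ, hB⟩ := hB
  have hk : Complex.I * κ ≠ 0 := by simp [hκ]
  -- Take `ζ` a small positive multiple of `iκ/ω`. The state `c + ζ` cannot be steered to `c`, and
  -- `c - ζ` cannot be reached from `c`.
  have point : ∀ r : ℝ, 0 < r → ∃ ζ : ℂ, ‖ζ‖ < r ∧ 0 < (ω * ζ / (Complex.I * κ)).re := by
    intro r hr
    have hν : 0 < ‖Complex.I * κ / ω‖ := norm_pos_iff.2 (div_ne_zero hk hω)
    refine ⟨((r / 2 / ‖Complex.I * κ / ω‖ : ℝ) : ℂ) * (Complex.I * κ / ω), ?_, ?_⟩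
    · rw [norm_mul, Complex.norm_real, Real.norm_of_nonneg (by positivity),
        div_mul_cancel₀ _ hν.ne']
      linarith
    · have : ω * (((r / 2 / ‖Complex.I * κ / ω‖ : ℝ) : ℂ) * (Complex.I * κ / ω)) /
          (Complex.I * κ) = ((r / 2 / ‖Complex.I * κ / ω‖ : ℝ) : ℂ) := by
        field_simp
      rw [this, Complex.ofReal_re]
      positivity
  have mem : ∀ (r : ℝ) (ζ : ℂ), ‖ζ‖ < r → J ((c + ζ : ℂ) : Sphere) ∈ disc η r := by
    intro r ζ hζ
    rw [hdisc]
    exact ⟨c + ζ, hJ _, by simpa using hζ⟩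
  constructor
  · rintro ⟨δ, ρ, hδ, -, hρ, h⟩
    obtain ⟨t, ht, r, hr, hsub⟩ := exists_time_exists_disc_subset hδ hτ hρ (h κ hΩ)
    obtain ⟨ζ, hζ, hζ'⟩ := point r hr
    have hin := hsub (mem r ζ hζ)
    simp only [controllableSet, mem_iUnion] at hin
    obtain ⟨t₀, ht₀, ε, x, hε, hx, hx0, hx1⟩ := hin
    obtain ⟨za, zb, hza, hzb, hre⟩ := hB t₀ ⟨ht₀.1, ht₀.2.trans ht.2⟩ ε x hε hx (Or.inr hx1)
    rw [hx0, hJ, OnePoint.coe_eq_coe] at hza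
    rw [hx1, hJη, OnePoint.coe_eq_coe] at hzb
    rw [← hza, ← hzb, show ω * (c - (c + ζ)) / (Complex.I * κ) = -(ω * ζ / (Complex.I * κ)) by
      ring, Complex.neg_re] at hre
    linarith
  · rintro ⟨δ, ρ, hδ, -, hρ, h⟩
    obtain ⟨t, ht, r, hr, hsub⟩ := exists_time_exists_disc_subset hδ hτ hρ (h κ hΩ)
    obtain ⟨ζ, hζ, hζ'⟩ := point r hr
    have hin := hsub (mem r (-ζ) (by rwa [norm_neg]))
    simp only [reachableSet, controllableSet, mem_iUnion, mem_ofPred_eq] at hin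
    obtain ⟨t₀, ht₀, ε, x, hε, hx, hx0, hx1⟩ := hin
    obtain ⟨za, zb, hza, hzb, hre⟩ := hB t₀ ⟨ht₀.1, ht₀.2.trans ht.2⟩ ε x hε hx (Or.inl hx0)
    rw [hx1, hJ, OnePoint.coe_eq_coe] at hzb
    rw [hx0, hJη, OnePoint.coe_eq_coe] at hza
    rw [← hza, ← hzb, show ω * (c + -ζ - c) / (Complex.I * κ) = -(ω * ζ / (Complex.I * κ)) by
      ring, Complex.neg_re] at hre
    linarith

/-- If `c²` is real, it lies outside `(n₁², n₂²)` and `e - c²` has a constant sign, so `ω = ±1`.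
Otherwise `e - c²` has the fixed nonzero imaginary part `-Im c²`, and `ω = ±i` makes the real part
equal to `|Im c²|`. -/
theorem exists_separating_direction {n₁ n₂ : ℝ} (hn₁ : 0 < n₁) (hn₂ : n₁ < n₂) {c : ℂ}
    (hc : (c : Sphere) ∉ regularEquilibria n₁ n₂) :
    ∃ (ω : ℂ) (m : ℝ), 0 < m ∧ ‖ω‖ = 1 ∧ ∀ e : ℝ, n₁ ^ 2 ≤ e → e ≤ n₂ ^ 2 →
      m * ‖(e : ℂ) - c ^ 2‖ ≤ (ω * (e - c ^ 2)).re := by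
  have real_case : (c ^ 2).im = 0 → c ^ 2 = (((c ^ 2).re : ℝ) : ℂ) := fun h =>
    Complex.ext (by simp) (by simpa using h)
  by_cases him : (c ^ 2).im = 0
  · have hre := real_case him
    set d := (c ^ 2).re with hd
    by_cases h1 : d ≤ n₁ ^ 2
    · refine ⟨1, 1, one_pos, by simp, fun e he _ => ?_⟩
      rw [hre, ← Complex.ofReal_sub, Complex.norm_real, one_mul, one_mul, Complex.ofReal_re,
        Real.norm_of_nonneg (by linarith)]
    · by_cases h2 : n₂ ^ 2 ≤ d
      · refine ⟨-1, 1, one_pos, by simp, fun e _ he => ?_⟩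
        rw [hre, ← Complex.ofReal_sub, Complex.norm_real, one_mul, neg_one_mul, Complex.neg_re,
          Complex.ofReal_re, Real.norm_of_nonpos (by linarith)]
      · exfalso
        push Not at h1 h2
        have hmul : c.re * c.im = 0 := by
          have : (c ^ 2).im = 2 * (c.re * c.im) := by rw [sq, Complex.mul_im]; ring
          linarith
        have hd' : d = c.re ^ 2 - c.im ^ 2 := by rw [hd, sq, Complex.mul_re]; ring
        have hci : c.im = 0 := by
          rcases mul_eq_zero.1 hmul with h | h
          · rw [h] at hd'
            nlinarith [sq_nonneg c.im, sq_nonneg n₁]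
          · exact h
        rw [hci] at hd'
        refine hc ⟨c.re, ?_, ?_⟩
        · rcases le_total 0 c.re with h | h
          · exact Or.inr ⟨by nlinarith, by nlinarith⟩
          · exact Or.inl ⟨by nlinarith, by nlinarith⟩
        · simp only [OnePoint.coe_eq_coe]
          exact Complex.ext (by simp) (by simp [hci])
  · set d := (c ^ 2).im with hd
    have hd0 : 0 < |d| := abs_pos.2 him
    have hN : 0 < n₂ ^ 2 + ‖c‖ ^ 2 := by have := hn₁.trans hn₂; positivity
    refine ⟨Complex.I * ((SignType.sign d : ℝ) : ℂ), |d| / (n₂ ^ 2 + ‖c‖ ^ 2), by positivity, ?_,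
      fun e he he' => ?_⟩
    · rcases lt_or_gt_of_ne him with h | h <;> simp [h]
    · have h1 : ‖(e : ℂ) - c ^ 2‖ ≤ n₂ ^ 2 + ‖c‖ ^ 2 := by
        refine (norm_sub_le _ _).trans (add_le_add ?_ (by simp))
        rw [Complex.norm_real, Real.norm_of_nonneg (by nlinarith)]
        exact he'
      have h2 : (Complex.I * ((SignType.sign d : ℝ) : ℂ) * (e - c ^ 2)).re = |d| := by
        have : (Complex.I * ((SignType.sign d : ℝ) : ℂ) * (e - c ^ 2)).re =
            (SignType.sign d : ℝ) * (c ^ 2).im := by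
          simp [Complex.mul_re, Complex.mul_im]
        rw [this, ← hd, sign_mul_self]
      rw [h2]
      calc |d| / (n₂ ^ 2 + ‖c‖ ^ 2) * ‖(e : ℂ) - c ^ 2‖
          ≤ |d| / (n₂ ^ 2 + ‖c‖ ^ 2) * (n₂ ^ 2 + ‖c‖ ^ 2) := by gcongr
        _ = |d| := by field_simp

theorem not_uniformSTLC {n₁ n₂ s₀ : ℝ} (hn₁ : 0 < n₁) (hn₂ : n₁ < n₂) {κ : ℂ} (hκ : κ ≠ 0)
    {η : Sphere} (hη : η ∉ regularEquilibria n₁ n₂) {Ω : Set ℂ} (hΩ : κ ∈ Ω) :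
    ¬ UniformSTLCTo n₁ n₂ s₀ Ω η ∧ ¬ UniformSTLCFrom n₁ n₂ s₀ Ω η := by
  have hn : n₁ ^ 2 ≤ n₂ ^ 2 := by gcongr
  induction η using OnePoint.rec with
  | infty =>
    refine not_uniformSTLC_of_barrier (c := 0) hκ (by simp) negInv_negInv negInv_infty
      (fun r => ?_) (hasLocalBarrier_infty hn hκ) hΩ
    simp only [sub_zero]
    rfl
  | coe c =>
    obtain ⟨ω, m, hm, hω, h⟩ := exists_separating_direction hn₁ hn₂ hη
    exact not_uniformSTLC_of_barrier (J := id) hκ (norm_pos_iff.1 (hω ▸ one_pos)) (fun _ => rfl)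
      rfl (fun r => rfl) (hasLocalBarrier_coe hn hκ hm hω h) hΩ

/-! ### Smooth trajectories and the flat output -/

theorem isTrajectory_of_hasDerivAt {κ : ℂ} {ε : ℝ → ℝ} {s₀ s₁ : ℝ} {z : ℝ → ℂ}
    (hz : ∀ s ∈ Icc s₀ s₁, HasDerivAt z (Complex.I * κ * (-(z s) ^ 2 + (ε s : ℂ))) s)
    (hε : ContinuousOn ε (Icc s₀ s₁)) :
    IsTrajectory κ ε s₀ s₁ (fun s => (z s : Sphere)) := by
  have hzc : ContinuousOn z (Icc s₀ s₁) := fun s hs => (hz s hs).continuousAt.continuousWithinAt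
  have hεc : ContinuousOn (fun s => (ε s : ℂ)) (Icc s₀ s₁) :=
    Complex.continuous_ofReal.comp_continuousOn hε
  refine ⟨OnePoint.continuous_coe.comp_continuousOn hzc, ?_, ?_⟩
  · intro a b z' ha hab hb hzz
    have hsub : Icc a b ⊆ Icc s₀ s₁ := Icc_subset_Icc ha hb
    have heq : ∀ s ∈ Icc a b, z s = z' s := fun s hs => OnePoint.coe_eq_coe.1 (hzz s hs)
    rw [← heq a ⟨le_rfl, hab⟩, ← heq b ⟨hab, le_rfl⟩]
    have h1 : ∫ s in a..b, Complex.I * κ * (-(z' s) ^ 2 + (ε s : ℂ)) =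
        ∫ s in a..b, Complex.I * κ * (-(z s) ^ 2 + (ε s : ℂ)) := by
      refine intervalIntegral.integral_congr fun s hs => ?_
      rw [uIcc_of_le hab] at hs
      simp only [heq s hs]
    rw [h1]
    refine (intervalIntegral.integral_eq_sub_of_hasDerivAt (fun s hs => ?_) ?_).symm
    · rw [uIcc_of_le hab] at hs
      exact hz s (hsub hs)
    · refine ContinuousOn.intervalIntegrable ?_
      rw [uIcc_of_le hab]
      exact continuousOn_const.mul
        (((hzc.mono hsub).pow 2).neg.add (hεc.mono hsub))
  · intro a b w ha hab hb hw
    have hsub : Icc a b ⊆ Icc s₀ s₁ := Icc_subset_Icc ha hb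
    have hne : ∀ s ∈ Icc a b, z s ≠ 0 ∧ w s = -1 / z s := by
      intro s hs
      have h := hw s hs
      rw [negInv_coe] at h
      split_ifs at h with h0
      · exact absurd h (OnePoint.infty_ne_coe _)
      · exact ⟨h0, (OnePoint.coe_eq_coe.1 h).symm⟩
    rw [(hne a ⟨le_rfl, hab⟩).2, (hne b ⟨hab, le_rfl⟩).2]
    have h1 : ∫ s in a..b, Complex.I * κ * (-1 + (ε s : ℂ) * (w s) ^ 2) =
        ∫ s in a..b, Complex.I * κ * (-(z s) ^ 2 + (ε s : ℂ)) / (z s) ^ 2 := by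
      refine intervalIntegral.integral_congr fun s hs => ?_
      rw [uIcc_of_le hab] at hs
      have := (hne s hs).1
      simp only [(hne s hs).2]
      field_simp
    rw [h1]
    refine (intervalIntegral.integral_eq_sub_of_hasDerivAt (f := fun s => -1 / z s)
      (fun s hs => ?_) ?_).symm
    · rw [uIcc_of_le hab] at hs
      refine ((hasDerivAt_const s (-1 : ℂ)).div (hz s (hsub hs)) (hne s hs).1).congr_deriv ?_
      ring
    · refine ContinuousOn.intervalIntegrable ?_
      rw [uIcc_of_le hab]
      exact (continuousOn_const.mul (((hzc.mono hsub).pow 2).neg.add (hεc.mono hsub))).div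
        ((hzc.mono hsub).pow 2) fun s hs => pow_ne_zero 2 (hne s hs).1

/- In the coordinate `x = η + iκ(p + iq)` the system with control `ε = η² + u` reads
`q' = Im(-2iηκ(p + iq) + κ²(p + iq)²)`, `p' = u + Re(-2iηκ(p + iq) + κ²(p + iq)²)`.
The first equation is `Im(κ²) p² - 2 β p + γ = 0` with `β`, `γ` as below, so that `p` and `u` are
determined by `q`, `d = q'` and `e = q''`. -/

/-- Half of the linear coefficient of the quadratic equation that determines `p`. -/
noncomputable def flatSlope (η : ℝ) (κ : ℂ) (q : ℝ) : ℝ := η * κ.re - (κ ^ 2).re * q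

/-- The constant coefficient of the quadratic equation that determines `p`. -/
noncomputable def flatConst (η : ℝ) (κ : ℂ) (q d : ℝ) : ℝ :=
  2 * η * κ.im * q - (κ ^ 2).im * q ^ 2 - d

/-- The normalized discriminant of the quadratic equation that determines `p`. -/
noncomputable def flatDiscr (η : ℝ) (κ : ℂ) (q d : ℝ) : ℝ :=
  1 - (κ ^ 2).im * flatConst η κ q d / flatSlope η κ q ^ 2

/-- The small root `p` of the quadratic equation. -/
noncomputable def flatRoot (η : ℝ) (κ : ℂ) (q d : ℝ) : ℝ :=
  flatConst η κ q d / (flatSlope η κ q * (1 + √(flatDiscr η κ q d)))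

/-- The derivative `p'` in terms of `q`, `q'`, `q''`. -/
noncomputable def flatRootDeriv (η : ℝ) (κ : ℂ) (q d e : ℝ) : ℝ :=
  (2 * (κ ^ 2).re * d * flatRoot η κ q d +
    (2 * η * κ.im * d - 2 * (κ ^ 2).im * q * d - e)) /
      (2 * flatSlope η κ q * √(flatDiscr η κ q d))

/-- The control `u` in terms of `q`, `q'`, `q''`. -/
noncomputable def flatControl (η : ℝ) (κ : ℂ) (q d e : ℝ) : ℝ :=
  flatRootDeriv η κ q d e - 2 * η * (κ.re * q + κ.im * flatRoot η κ q d) -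
    (κ ^ 2).re * (flatRoot η κ q d ^ 2 - q ^ 2) + 2 * (κ ^ 2).im * flatRoot η κ q d * q

section Flat

variable {η : ℝ} {κ : ℂ} {q d : ℝ}

theorem mul_flatRoot (hb : flatSlope η κ q ≠ 0) (hd : 0 < flatDiscr η κ q d) :
    (κ ^ 2).im * flatRoot η κ q d = flatSlope η κ q * (1 - √(flatDiscr η κ q d)) := by
  have hr := Real.sq_sqrt hd.le
  have hr0 := Real.sqrt_nonneg (flatDiscr η κ q d)
  set r := √(flatDiscr η κ q d) with hrdef
  have h1 : (κ ^ 2).im * flatConst η κ q d = flatSlope η κ q ^ 2 * (1 - r ^ 2) := by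
    rw [hr, flatDiscr]
    field_simp
    ring
  have h2 : (1 + r) ≠ 0 := by positivity
  rw [flatRoot, ← hrdef, ← mul_div_assoc, h1]
  field_simp
  ring

theorem flatRoot_quadratic (hb : flatSlope η κ q ≠ 0) (hd : 0 < flatDiscr η κ q d) :
    (κ ^ 2).im * flatRoot η κ q d ^ 2 - 2 * flatSlope η κ q * flatRoot η κ q d +
      flatConst η κ q d = 0 := by
  have h1 := mul_flatRoot hb hd
  have hr0 := Real.sqrt_nonneg (flatDiscr η κ q d)
  have h2 : flatRoot η κ q d * (flatSlope η κ q * (1 + √(flatDiscr η κ q d))) =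
      flatConst η κ q d := by
    rw [flatRoot]
    refine div_mul_cancel₀ _ (mul_ne_zero hb (by positivity))
  linear_combination flatRoot η κ q d * h1 - h2

/-- The sign condition selects the branch: by the quadratic equation, the discriminant is the square
of `1 - Im(κ²)p/β`, and positivity makes this number its square root. -/
theorem flatRoot_eq {p : ℝ} (hb : flatSlope η κ q ≠ 0)
    (hp : 0 < 1 - (κ ^ 2).im * p / flatSlope η κ q)
    (h : (κ ^ 2).im * p ^ 2 - 2 * flatSlope η κ q * p + flatConst η κ q d = 0) :
    flatRoot η κ q d = p := by
  have hc : flatConst η κ q d = p * (2 * flatSlope η κ q - (κ ^ 2).im * p) := by linarith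
  have h1 : flatDiscr η κ q d = (1 - (κ ^ 2).im * p / flatSlope η κ q) ^ 2 := by
    rw [flatDiscr, hc]
    field_simp
    ring
  have h2 : √(flatDiscr η κ q d) = 1 - (κ ^ 2).im * p / flatSlope η κ q := by
    rw [h1, Real.sqrt_sq hp.le]
  have h3 : flatSlope η κ q * (1 + √(flatDiscr η κ q d)) =
      2 * flatSlope η κ q - (κ ^ 2).im * p := by
    rw [h2]
    field_simp
    ring
  have h4 : 2 * flatSlope η κ q - (κ ^ 2).im * p ≠ 0 := by
    rw [← h3]
    exact mul_ne_zero hb (by positivity)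
  rw [flatRoot, h3, hc, mul_div_cancel_right₀ _ h4]

theorem hasDerivAt_flatRoot {q d : ℝ → ℝ} {e s : ℝ} (hq : HasDerivAt q (d s) s)
    (hd : HasDerivAt d e s) (hb : flatSlope η κ (q s) ≠ 0)
    (hD : 0 < flatDiscr η κ (q s) (d s)) :
    HasDerivAt (fun t => flatRoot η κ (q t) (d t)) (flatRootDeriv η κ (q s) (d s) e) s := by
  have hβ : HasDerivAt (fun t => flatSlope η κ (q t)) (-((κ ^ 2).re * d s)) s := by
    simpa [flatSlope] using (hq.const_mul (κ ^ 2).re).const_sub (η * κ.re)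
  have hγ : HasDerivAt (fun t => flatConst η κ (q t) (d t))
      (2 * η * κ.im * d s - 2 * (κ ^ 2).im * q s * d s - e) s := by
    refine (((hq.const_mul (2 * η * κ.im)).sub
      ((hq.pow 2).const_mul (κ ^ 2).im)).sub hd).congr_deriv ?_
    norm_num
    ring
  have hΔ : DifferentiableAt ℝ (fun t => flatDiscr η κ (q t) (d t)) s :=
    ((hγ.differentiableAt.const_mul (κ ^ 2).im).div (hβ.differentiableAt.pow 2)
      (pow_ne_zero 2 hb)).const_sub 1
  have hP : DifferentiableAt ℝ (fun t => flatRoot η κ (q t) (d t)) s :=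
    hγ.differentiableAt.div (hβ.differentiableAt.mul ((hΔ.sqrt hD.ne').const_add 1))
      (mul_ne_zero hb (by positivity))
  have hP' := hP.hasDerivAt
  set P' := deriv (fun t => flatRoot η κ (q t) (d t)) s with hP'def
  -- The explicit formula is used only for differentiability; the value of the derivative comes from
  -- differentiating the quadratic identity and comparing with zero.
  have hzero : (fun t => (κ ^ 2).im * flatRoot η κ (q t) (d t) ^ 2 -
      2 * flatSlope η κ (q t) * flatRoot η κ (q t) (d t) + flatConst η κ (q t) (d t))
      =ᶠ[nhds s] fun _ => 0 := by
    filter_upwards [hβ.continuousAt.eventually_ne hb, hΔ.continuousAt.eventually_const_lt hD]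
      with t h1 h2
    exact flatRoot_quadratic h1 h2
  have h1 := (((hP'.pow 2).const_mul (κ ^ 2).im).sub ((hβ.const_mul 2).mul hP')).add hγ
  have h2 := h1.unique ((hasDerivAt_const s (0 : ℝ)).congr_of_eventuallyEq hzero)
  have h3 := mul_flatRoot hb hD
  refine hP'.congr_deriv (Eq.symm ?_)
  have hr : 0 < √(flatDiscr η κ (q s) (d s)) := Real.sqrt_pos.2 hD
  rw [flatRootDeriv, div_eq_iff (by simp [hb, hr.ne'])]
  simp only [Nat.cast_ofNat, Nat.add_one_sub_one, pow_one] at h2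
  linear_combination h2 - 2 * P' * h3

theorem continuousAt_flat {x : ℂ × ℝ × ℝ × ℝ} (hb : flatSlope η x.1 x.2.1 ≠ 0)
    (hD : 0 < flatDiscr η x.1 x.2.1 x.2.2.1) :
    ContinuousAt (fun y : ℂ × ℝ × ℝ × ℝ => flatDiscr η y.1 y.2.1 y.2.2.1) x ∧
    ContinuousAt (fun y : ℂ × ℝ × ℝ × ℝ => flatControl η y.1 y.2.1 y.2.2.1 y.2.2.2) x := by
  have hβ : ContinuousAt (fun y : ℂ × ℝ × ℝ × ℝ => flatSlope η y.1 y.2.1) x := by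
    unfold flatSlope; fun_prop
  have hγ : ContinuousAt (fun y : ℂ × ℝ × ℝ × ℝ => flatConst η y.1 y.2.1 y.2.2.1) x := by
    unfold flatConst; fun_prop
  have hΔ : ContinuousAt (fun y : ℂ × ℝ × ℝ × ℝ => flatDiscr η y.1 y.2.1 y.2.2.1) x := by
    unfold flatDiscr
    exact continuousAt_const.sub (ContinuousAt.div (ContinuousAt.mul (by fun_prop) hγ)
      (hβ.pow 2) (pow_ne_zero 2 hb))
  have hP : ContinuousAt (fun y : ℂ × ℝ × ℝ × ℝ => flatRoot η y.1 y.2.1 y.2.2.1) x := by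
    unfold flatRoot
    exact hγ.div (hβ.mul (continuousAt_const.add hΔ.sqrt)) (mul_ne_zero hb (by positivity))
  have hP' : ContinuousAt
      (fun y : ℂ × ℝ × ℝ × ℝ => flatRootDeriv η y.1 y.2.1 y.2.2.1 y.2.2.2) x := by
    unfold flatRootDeriv
    refine ContinuousAt.div ?_ ((continuousAt_const.mul hβ).mul hΔ.sqrt)
      (mul_ne_zero (mul_ne_zero two_ne_zero hb) (Real.sqrt_pos.2 hD).ne')
    fun_prop
  refine ⟨hΔ, ?_⟩
  unfold flatControl
  fun_prop

end Flat

/-- Parameters `κ` such that outputs `q` with `|q|, |q'|, |q''| < μ` have admissible controls. -/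
structure IsFlatBound (n₁ n₂ η μ : ℝ) (κ : ℂ) : Prop where
  slope_ne : ∀ q, |q| < μ → flatSlope η κ q ≠ 0
  discr_pos : ∀ q d, |q| < μ → |d| < μ → 0 < flatDiscr η κ q d
  control_mem : ∀ q d e, |q| < μ → |d| < μ → |e| < μ →
    n₁ ^ 2 ≤ η ^ 2 + flatControl η κ q d e ∧ η ^ 2 + flatControl η κ q d e ≤ n₂ ^ 2
  root_small : ∀ q p, |q| < μ → |p| < μ → 0 < 1 - (κ ^ 2).im * p / flatSlope η κ q

/-- At `(κ₀, 0, 0, 0)` the slope is `η Re κ₀ ≠ 0`, the discriminant is `1` and the control `u` is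
`0`. Every requirement is therefore an open condition satisfied there, and it persists on a ball by
continuity, uniformly in `κ`. -/
theorem exists_isFlatBound {n₁ n₂ η : ℝ} (h1 : n₁ ^ 2 < η ^ 2) (h2 : η ^ 2 < n₂ ^ 2) {κ₀ : ℂ}
    (hκ₀ : κ₀.re ≠ 0) :
    ∃ μ : ℝ, 0 < μ ∧ μ ≤ 1 ∧ ∀ κ : ℂ, ‖κ - κ₀‖ < μ →
      IsFlatBound n₁ n₂ η μ κ ∧ ‖κ₀‖ / 2 < ‖κ‖ := by
  have hη : η ≠ 0 := by
    rintro rfl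
    nlinarith [sq_nonneg n₁]
  set x₀ : ℂ × ℝ × ℝ × ℝ := (κ₀, 0, 0, 0) with hx₀
  have hb : flatSlope η x₀.1 x₀.2.1 ≠ 0 := by simp [hx₀, flatSlope, hη, hκ₀]
  have hc : flatConst η x₀.1 x₀.2.1 x₀.2.2.1 = 0 := by simp [hx₀, flatConst]
  have hD : flatDiscr η x₀.1 x₀.2.1 x₀.2.2.1 = 1 := by simp [flatDiscr, hc]
  have hP : flatRoot η x₀.1 x₀.2.1 x₀.2.2.1 = 0 := by simp [flatRoot, hc]
  have hU : flatControl η x₀.1 x₀.2.1 x₀.2.2.1 x₀.2.2.2 = 0 := by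
    simp only [flatControl, flatRootDeriv, hP]
    simp [hx₀]
  obtain ⟨cD, cU⟩ := continuousAt_flat (η := η) hb (hD.symm ▸ one_pos)
  have cb : ContinuousAt (fun y : ℂ × ℝ × ℝ × ℝ => flatSlope η y.1 y.2.1) x₀ := by
    unfold flatSlope; fun_prop
  have cr : ContinuousAt (fun y : ℂ × ℝ × ℝ × ℝ =>
      1 - (y.1 ^ 2).im * y.2.2.1 / flatSlope η y.1 y.2.1) x₀ :=
    continuousAt_const.sub (ContinuousAt.div (by fun_prop) cb hb)
  have cκ : ContinuousAt (fun y : ℂ × ℝ × ℝ × ℝ => ‖y.1‖) x₀ := by fun_prop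
  have hκpos : 0 < ‖κ₀‖ := norm_pos_iff.2 fun h => hκ₀ (by simp [h])
  have e1 := cb.eventually_ne hb
  have e2 := cD.eventually_const_lt (u := 0) (by simp only [hD]; exact one_pos)
  have e3 := cU.eventually_const_lt (u := n₁ ^ 2 - η ^ 2) (by simp only [hU]; linarith)
  have e4 := cU.eventually_lt_const (u := n₂ ^ 2 - η ^ 2) (by simp only [hU]; linarith)
  have e5 := cr.eventually_const_lt (u := 0) (by simp [hx₀])
  have e6 := cκ.eventually_const_lt (u := ‖κ₀‖ / 2) (by simp only [hx₀]; linarith)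
  obtain ⟨μ, hμ, H⟩ := Metric.eventually_nhds_iff.1
    (e1.and (e2.and (e3.and (e4.and (e5.and e6)))))
  refine ⟨min μ 1, by positivity, min_le_right _ _, fun κ hκ => ?_⟩
  have key : ∀ q d e : ℝ, |q| < min μ 1 → |d| < min μ 1 → |e| < min μ 1 →
      dist ((κ, q, d, e) : ℂ × ℝ × ℝ × ℝ) x₀ < μ := by
    intro q d e hq hd he
    simp only [hx₀, Prod.dist_eq, Real.dist_eq, sub_zero, dist_eq_norm κ, max_lt_iff]
    exact ⟨hκ.trans_le (min_le_left _ _), hq.trans_le (min_le_left _ _),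
      hd.trans_le (min_le_left _ _), he.trans_le (min_le_left _ _)⟩
  have z0 : |(0 : ℝ)| < min μ 1 := by simpa using hμ
  refine ⟨⟨fun q hq => (H (key q 0 0 hq z0 z0)).1, fun q d hq hd => (H (key q d 0 hq hd z0)).2.1,
    fun q d e hq hd he => ?_, fun q p hq hp => (H (key q p 0 hq hp z0)).2.2.2.2.1⟩,
    (H (key 0 0 0 z0 z0 z0)).2.2.2.2.2⟩
  obtain ⟨-, -, h3, h4, -⟩ := H (key q d e hq hd he)
  simp only at h3 h4
  constructor <;> linarith

theorem mem_controllableAt_of_output {n₁ n₂ η μ s₀ T : ℝ} {κ : ℂ}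
    (hκ : IsFlatBound n₁ n₂ η μ κ) (hn : n₁ ^ 2 ≤ n₂ ^ 2) (hT : 0 ≤ T) {q d e : ℝ → ℝ}
    (hq : ∀ s, HasDerivAt q (d s) s) (hd : ∀ s, HasDerivAt d (e s) s) (he : Continuous e)
    (hbound : ∀ s ∈ Icc s₀ (s₀ + T), |q s| < μ ∧ |d s| < μ ∧ |e s| < μ) {v₀ v₁ : ℂ}
    (hv₀ : ‖v₀‖ < μ) (hv₁ : ‖v₁‖ < μ) (hq₀ : q s₀ = v₀.im) (hq₁ : q (s₀ + T) = v₁.im)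
    (hd₀ : d s₀ = (-2 * Complex.I * η * κ * v₀ + κ ^ 2 * v₀ ^ 2).im)
    (hd₁ : d (s₀ + T) = (-2 * Complex.I * η * κ * v₁ + κ ^ 2 * v₁ ^ 2).im) :
    ((η + Complex.I * κ * v₀ : ℂ) : Sphere) ∈
      controllableAt n₁ n₂ s₀ κ ((η + Complex.I * κ * v₁ : ℂ) : Sphere) T := by
  set u : ℝ → ℝ := fun s => flatControl η κ (q s) (d s) (e s) with hu
  set v : ℝ → ℂ := fun s => (flatRoot η κ (q s) (d s) : ℂ) + Complex.I * (q s : ℂ) with hv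
  -- Clamping changes nothing on the time interval and keeps the control feasible after it.
  set ε : ℝ → ℝ := fun s => max (n₁ ^ 2) (min (n₂ ^ 2) (η ^ 2 + u s)) with hε
  have hεu : ∀ s ∈ Icc s₀ (s₀ + T), ε s = η ^ 2 + u s := by
    intro s hs
    obtain ⟨b1, b2, b3⟩ := hbound s hs
    obtain ⟨c1, c2⟩ := hκ.control_mem _ _ _ b1 b2 b3
    rw [hε]
    simp only [hu]
    rw [min_eq_right c2, max_eq_right c1]
  have hqc : Continuous q := continuous_iff_continuousAt.2 fun s => (hq s).continuousAt
  have hdc : Continuous d := continuous_iff_continuousAt.2 fun s => (hd s).continuousAt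
  have hvd : ∀ s ∈ Icc s₀ (s₀ + T),
      HasDerivAt v (u s + (-2 * Complex.I * η * κ * v s + κ ^ 2 * v s ^ 2)) s := by
    intro s hs
    obtain ⟨b1, b2, -⟩ := hbound s hs
    have hb := hκ.slope_ne _ b1
    have hD := hκ.discr_pos _ _ b1 b2
    have h1 := (hasDerivAt_flatRoot (hq s) (hd s) hb hD).ofReal_comp
    have h2 := (hq s).ofReal_comp.const_mul Complex.I
    refine (h1.add h2).congr_deriv (Eq.symm ?_)
    have h3 := flatRoot_quadratic hb hD
    simp only [hv, hu, flatControl]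
    unfold flatConst flatSlope at h3
    apply Complex.ext
    · simp [sq, Complex.mul_re, Complex.mul_im]
      ring
    · simp [sq, Complex.mul_re, Complex.mul_im] at h3 ⊢
      linear_combination h3
  have hzd : ∀ s ∈ Icc s₀ (s₀ + T), HasDerivAt (fun s => (η : ℂ) + Complex.I * κ * v s)
      (Complex.I * κ * (-((η : ℂ) + Complex.I * κ * v s) ^ 2 + (ε s : ℂ))) s := by
    intro s hs
    refine (((hvd s hs).const_mul (Complex.I * κ)).const_add (η : ℂ)).congr_deriv ?_
    rw [hεu s hs]
    push_cast
    linear_combination (Complex.I * κ ^ 3 * v s ^ 2) * Complex.I_sq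
  -- The values of `q` and `q'` at an end determine the whole state, since `Re w` is the small root
  -- there.
  have hend : ∀ s ∈ Icc s₀ (s₀ + T), ∀ w : ℂ, ‖w‖ < μ → q s = w.im →
      d s = (-2 * Complex.I * η * κ * w + κ ^ 2 * w ^ 2).im → v s = w := by
    intro s hs w hw hqw hdw
    obtain ⟨b1, b2, -⟩ := hbound s hs
    have : flatRoot η κ (q s) (d s) = w.re := by
      refine flatRoot_eq (hκ.slope_ne _ b1)
        (hκ.root_small _ _ b1 ((Complex.abs_re_le_norm w).trans_lt hw)) ?_
      rw [hdw, hqw]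
      unfold flatConst flatSlope
      simp [sq, Complex.mul_re, Complex.mul_im]
      ring
    simp only [hv]
    rw [this, hqw, mul_comm]
    exact Complex.re_add_im w
  have hεc : ContinuousOn ε (Icc s₀ (s₀ + T)) := by
    refine ContinuousOn.congr (f := fun s => η ^ 2 + u s) (fun s hs => ?_) hεu
    obtain ⟨b1, b2, -⟩ := hbound s hs
    refine ContinuousAt.continuousWithinAt (continuousAt_const.add ?_)
    exact ContinuousAt.comp (f := fun s => ((κ, q s, d s, e s) : ℂ × ℝ × ℝ × ℝ))
      (continuousAt_flat (x := (κ, q s, d s, e s)) (hκ.slope_ne _ b1) (hκ.discr_pos _ _ b1 b2)).2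
      (by fun_prop)
  have hs₀ : s₀ ∈ Icc s₀ (s₀ + T) := ⟨le_rfl, by linarith⟩
  have hs₁ : s₀ + T ∈ Icc s₀ (s₀ + T) := ⟨by linarith, le_rfl⟩
  refine ⟨ε, fun s => (((η : ℂ) + Complex.I * κ * v s : ℂ) : Sphere), ⟨?_, ?_⟩,
    isTrajectory_of_hasDerivAt hzd hεc, ?_, ?_⟩
  · have hqm := hqc.measurable
    have hdm := hdc.measurable
    have hem := he.measurable
    refine Measurable.aemeasurable ?_
    simp only [hε, hu, flatControl, flatRootDeriv, flatRoot, flatDiscr, flatConst, flatSlope]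
    fun_prop
  · exact Filter.Eventually.of_forall fun s => ⟨le_max_left _ _, max_le hn (min_le_left _ _)⟩
  · simp only [hend s₀ hs₀ v₀ hv₀ hq₀ hd₀]
  · simp only [hend (s₀ + T) hs₁ v₁ hv₁ hq₁ hd₁]

/-! ### Interpolation and uniform steering -/

theorem exists_hermite {q₁ d₁ T N μ : ℝ} (hT : 0 < T) (hT1 : T ≤ 1) (hq : |q₁| ≤ N)
    (hd : |d₁| ≤ N) (hN : 26 * N < μ * T ^ 2) :
    ∃ q d e : ℝ → ℝ, (∀ s, HasDerivAt q (d s) s) ∧ (∀ s, HasDerivAt d (e s) s) ∧ Continuous e ∧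
      (∀ s ∈ Icc 0 T, |q s| < μ ∧ |d s| < μ ∧ |e s| < μ) ∧
      q 0 = 0 ∧ d 0 = 0 ∧ q T = q₁ ∧ d T = d₁ := by
  -- The output is the cubic `a s² + b s³`. The constant `26 = 2·4 + 6·3` comes from `|a| ≤ 4N/T²`
  -- and `|b|T ≤ 3N/T²`, the worst case being the second derivative `2a + 6bs`.
  set a := 3 * q₁ / T ^ 2 - d₁ / T with ha
  set b := -2 * q₁ / T ^ 3 + d₁ / T ^ 2 with hb
  have hN0 : 0 ≤ N := (abs_nonneg _).trans hq
  have ha' : |a| ≤ 4 * (N / T ^ 2) := by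
    have : a = (3 * q₁ - d₁ * T) / T ^ 2 := by rw [ha]; field_simp
    rw [this, abs_div, abs_of_pos (by positivity : 0 < T ^ 2), ← mul_div_assoc]
    gcongr
    have h1 : |d₁ * T| ≤ N := by
      rw [abs_mul, abs_of_pos hT]
      exact (mul_le_of_le_one_right (abs_nonneg _) hT1).trans hd
    have h2 : |3 * q₁| ≤ 3 * N := by
      rw [abs_mul, abs_of_pos (by norm_num : (0 : ℝ) < 3)]
      linarith
    linarith [abs_sub (3 * q₁) (d₁ * T)]
  have hb' : |b| * T ≤ 3 * (N / T ^ 2) := by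
    have : b * T = (-2 * q₁ + d₁ * T) / T ^ 2 := by rw [hb]; field_simp
    rw [← abs_of_pos hT, ← abs_mul, abs_of_pos hT, this, abs_div,
      abs_of_pos (by positivity : 0 < T ^ 2), ← mul_div_assoc]
    gcongr
    have h1 : |d₁ * T| ≤ N := by
      rw [abs_mul, abs_of_pos hT]
      exact (mul_le_of_le_one_right (abs_nonneg _) hT1).trans hd
    have h2 : |-2 * q₁| ≤ 2 * N := by
      rw [abs_mul, abs_neg, abs_of_pos (by norm_num : (0 : ℝ) < 2)]
      linarith
    linarith [abs_add_le (-2 * q₁) (d₁ * T)]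
  have hNμ : 26 * (N / T ^ 2) < μ := by
    rw [← mul_div_assoc, div_lt_iff₀ (by positivity)]
    exact hN
  have bound : ∀ s ∈ Icc 0 T, ∀ i j : ℕ, ∀ A B : ℝ, 0 ≤ A → A ≤ 2 → 0 ≤ B → B ≤ 6 →
      |A * a * s ^ i + B * b * s ^ (j + 1)| < μ := by
    intro s hs i j A B hA hA2 hB hB6
    have h1 : s ≤ 1 := hs.2.trans hT1
    have h2 : |A * a * s ^ i| ≤ 2 * |a| := by
      rw [abs_mul, abs_mul, abs_of_nonneg hA, abs_of_nonneg (pow_nonneg hs.1 i)]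
      exact mul_le_of_le_one_right (by positivity) (pow_le_one₀ hs.1 h1) |>.trans
        (mul_le_mul_of_nonneg_right hA2 (abs_nonneg _))
    have h3 : |B * b * s ^ (j + 1)| ≤ 6 * (|b| * T) := by
      rw [abs_mul, abs_mul, abs_of_nonneg hB, abs_of_nonneg (pow_nonneg hs.1 _), mul_assoc]
      have : s ^ (j + 1) ≤ T := by
        rw [pow_succ]
        exact (mul_le_of_le_one_left hs.1 (pow_le_one₀ hs.1 h1)).trans hs.2
      have h4 : |b| * s ^ (j + 1) ≤ |b| * T := mul_le_mul_of_nonneg_left this (abs_nonneg _)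
      have h5 : 0 ≤ |b| * T := by positivity
      nlinarith [mul_le_mul_of_nonneg_left h4 hB]
    calc |A * a * s ^ i + B * b * s ^ (j + 1)| ≤ _ := abs_add_le _ _
      _ ≤ 26 * (N / T ^ 2) := by linarith
      _ < μ := hNμ
  refine ⟨fun s => a * s ^ 2 + b * s ^ 3, fun s => 2 * a * s + 3 * b * s ^ 2,
    fun s => 2 * a + 6 * b * s, fun s => ?_, fun s => ?_, by fun_prop, fun s hs => ⟨?_, ?_, ?_⟩,
    by simp, by simp, ?_, ?_⟩
  · refine (((hasDerivAt_pow 2 s).const_mul a).add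
      ((hasDerivAt_pow 3 s).const_mul b)).congr_deriv ?_
    norm_num
    ring
  · refine (((hasDerivAt_id s).const_mul (2 * a)).add
      ((hasDerivAt_pow 2 s).const_mul (3 * b))).congr_deriv ?_
    norm_num
    ring
  · simpa using bound s hs 2 2 1 1 (by norm_num) (by norm_num) (by norm_num) (by norm_num)
  · simpa using bound s hs 1 1 2 3 (by norm_num) (by norm_num) (by norm_num) (by norm_num)
  · simpa using bound s hs 0 0 2 6 (by norm_num) (by norm_num) (by norm_num) (by norm_num)
  · simp only [ha, hb]
    field_simp
    ring
  · simp only [ha, hb]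
    field_simp
    ring

theorem exists_uniform_local_control {n₁ n₂ η s₀ : ℝ} (h1 : n₁ ^ 2 < η ^ 2) (h2 : η ^ 2 < n₂ ^ 2)
    {κ₀ : ℂ} (hκ₀ : κ₀.re ≠ 0) :
    ∃ δ c : ℝ, 0 < δ ∧ 0 < c ∧ ∀ κ ∈ Metric.ball κ₀ δ, ∀ T : ℝ, 0 < T → T ≤ 1 →
      ∀ x : ℂ, ‖x - η‖ < c * T ^ 2 →
        (x : Sphere) ∈ controllableAt n₁ n₂ s₀ κ ((η : ℂ) : Sphere) T ∧
        ((η : ℂ) : Sphere) ∈ controllableAt n₁ n₂ s₀ κ (x : Sphere) T := by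
  obtain ⟨μ, hμ, hμ1, H⟩ := exists_isFlatBound h1 h2 hκ₀
  have hn : n₁ ^ 2 ≤ n₂ ^ 2 := (h1.trans h2).le
  have hκpos : 0 < ‖κ₀‖ := norm_pos_iff.2 fun h => hκ₀ (by simp [h])
  set K := ‖κ₀‖ + 1 with hK
  set L := 1 + 2 * |η| * K + K ^ 2 with hL
  have hL1 : 1 ≤ L := by
    have : 0 ≤ 2 * |η| * K + K ^ 2 := by positivity
    linarith
  -- `L‖v‖` will bound both `q` and `q'` at the endpoint. In `54 = 2·27`, the factor `2` pays for
  -- `‖κ‖ > ‖κ₀‖/2`, and `27` exceeds the interpolation constant `26`.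
  refine ⟨μ, ‖κ₀‖ * μ / (54 * L), hμ, by positivity, fun κ hκ T hT hT1 x hx => ?_⟩
  rw [mem_ball_iff_norm] at hκ
  obtain ⟨hflat, hκlow⟩ := H κ hκ
  have hκ0 : 0 < ‖κ‖ := by linarith
  have hκne : κ ≠ 0 := norm_pos_iff.1 hκ0
  have hκK : ‖κ‖ ≤ K := by
    have := norm_le_norm_add_norm_sub' κ κ₀
    linarith
  set v : ℂ := (x - η) / (Complex.I * κ) with hv
  have hxv : x = η + Complex.I * κ * v := by
    rw [hv]
    field_simp
    ring
  have hT2 : T ^ 2 ≤ 1 := pow_le_one₀ hT.le hT1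
  have hvb : 26 * (L * ‖v‖) < μ * T ^ 2 := by
    have e1 : ‖v‖ * ‖κ‖ = ‖x - η‖ := by
      rw [hv, norm_div, norm_mul, Complex.norm_I, one_mul, div_mul_cancel₀ _ hκ0.ne']
    have e2 : ‖x - η‖ * (54 * L) < ‖κ₀‖ * μ * T ^ 2 := by
      rw [div_mul_eq_mul_div, lt_div_iff₀ (by positivity)] at hx
      exact hx
    have e3 : ‖κ₀‖ * (L * ‖v‖ * 27) ≤ ‖x - η‖ * (54 * L) := by
      rw [← e1]
      have := mul_le_mul_of_nonneg_right hκlow.le (by positivity : 0 ≤ L * ‖v‖ * 54)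
      linarith
    have e4 : ‖κ₀‖ * (L * ‖v‖ * 27) < ‖κ₀‖ * (μ * T ^ 2) := by linarith
    have e5 := lt_of_mul_lt_mul_left e4 hκpos.le
    have : 0 ≤ L * ‖v‖ := by positivity
    linarith
  have hLv : ‖v‖ ≤ L * ‖v‖ := le_mul_of_one_le_left (norm_nonneg _) hL1
  have hvμ : ‖v‖ < μ := by
    have : μ * T ^ 2 ≤ μ := mul_le_of_le_one_right hμ.le hT2
    linarith [norm_nonneg v]
  set D := (-2 * Complex.I * η * κ * v + κ ^ 2 * v ^ 2).im with hD
  have hDb : |D| ≤ L * ‖v‖ := by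
    refine (Complex.abs_im_le_norm _).trans ((norm_add_le _ _).trans ?_)
    simp only [norm_mul, norm_neg, norm_pow, Complex.norm_I, Complex.norm_real, Real.norm_eq_abs,
      Complex.norm_ofNat, mul_one]
    have e1 : 2 * |η| * ‖κ‖ * ‖v‖ ≤ 2 * |η| * K * ‖v‖ := by gcongr
    have e2 : ‖κ‖ ^ 2 * ‖v‖ ^ 2 ≤ K ^ 2 * ‖v‖ := by
      gcongr
      rw [sq]
      exact mul_le_of_le_one_left (norm_nonneg _) (hvμ.le.trans hμ1)
    rw [hL]
    linarith [norm_nonneg v]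
  have him : |v.im| ≤ L * ‖v‖ := (Complex.abs_im_le_norm v).trans hLv
  have hη : ((η : ℂ) : Sphere) = ((η + Complex.I * κ * 0 : ℂ) : Sphere) := by simp
  rw [hη, hxv]
  constructor
  -- To end at `η`, the interpolant is run backwards in time; this flips the sign of `q'`, hence the
  -- datum `-D`.
  · obtain ⟨q, d, e, hq, hd, he, hb, q0, d0, q1, d1⟩ :=
      exists_hermite (d₁ := -D) hT hT1 him (by rwa [abs_neg]) hvb
    have hr : ∀ s, HasDerivAt (fun s => s₀ + T - s) (-1) s := fun s => by
      simpa using (hasDerivAt_id s).const_sub (s₀ + T)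
    refine mem_controllableAt_of_output (q := fun s => q (s₀ + T - s))
      (d := fun s => -d (s₀ + T - s)) (e := fun s => e (s₀ + T - s)) hflat hn hT.le
      (fun s => ?_) (fun s => ?_) (by fun_prop) (fun s hs => ?_) hvμ (by simpa using hμ)
      ?_ ?_ ?_ ?_
    · exact ((hq (s₀ + T - s)).comp s (hr s)).congr_deriv (by ring)
    · exact ((hd (s₀ + T - s)).comp s (hr s)).neg.congr_deriv (by ring)
    · rw [abs_neg]
      exact hb _ ⟨by linarith [hs.2], by linarith [hs.1]⟩
    · simpa using q1
    · simpa using q0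
    · rw [← hD]
      simp [d1]
    · simpa using d0
  · obtain ⟨q, d, e, hq, hd, he, hb, q0, d0, q1, d1⟩ :=
      exists_hermite hT hT1 him hDb hvb
    have hr : ∀ s, HasDerivAt (fun s => s - s₀) 1 s := fun s => (hasDerivAt_id s).sub_const s₀
    refine mem_controllableAt_of_output (q := fun s => q (s - s₀))
      (d := fun s => d (s - s₀)) (e := fun s => e (s - s₀)) hflat hn hT.le
      (fun s => ?_) (fun s => ?_) (by fun_prop) (fun s hs => ?_) (by simpa using hμ) hvμ
      ?_ ?_ ?_ ?_
    · exact ((hq (s - s₀)).comp s (hr s)).congr_deriv (mul_one _)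
    · exact ((hd (s - s₀)).comp s (hr s)).congr_deriv (mul_one _)
    · exact hb _ ⟨by linarith [hs.1], by linarith [hs.2]⟩
    · simpa using q0
    · simpa using q1
    · simpa using d0
    · rw [← hD]
      simpa using d1

/-! ### From steering estimates to the radius function -/

theorem exists_radius_le_rMax {η : Sphere} {c : ℝ} (hc : 0 < c) {Ω : Set ℂ}
    {S : ℂ → ℝ → Set Sphere}
    (h : ∀ κ ∈ Ω, ∀ T : ℝ, 0 < T → T ≤ 1 → ∀ t, T < t → disc η (c * T ^ 2) ⊆ S κ t)
    (hη : disc η 0 = ∅) :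
    ∃ (δ : ℝ) (ρ : ℝ → ℝ≥0), 0 < δ ∧ ContinuousOn ρ (Ico 0 δ) ∧ StrictMonoOn ρ (Ico 0 δ) ∧
      ∀ κ ∈ Ω, ∀ t ∈ Ico 0 δ, (ρ t : ℝ≥0∞) ≤ rMax η (S κ t) := by
  -- The time `t/2` is used because steering must finish strictly before `t`; at `t = 0` the disc of
  -- radius `0` is empty.
  refine ⟨1, fun t => Real.toNNReal (c * (t / 2) ^ 2), one_pos, ?_, ?_, ?_⟩
  · exact (continuous_real_toNNReal.comp (by fun_prop)).continuousOn
  · intro s hs t ht hst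
    have h0 := hs.1
    have : 0 < t := h0.trans_lt hst
    rw [Real.toNNReal_lt_toNNReal_iff (by positivity)]
    gcongr
  · intro κ hκ t ht
    refine le_iSup₂_of_le (f := fun (r : ℝ≥0) (_ : disc η (r : ℝ) ⊆ S κ t) => (r : ℝ≥0∞))
      _ ?_ le_rfl
    rw [Real.coe_toNNReal _ (by positivity)]
    rcases ht.1.eq_or_lt with h0 | h0
    · rw [← h0]
      simp [hη]
    · exact h κ hκ (t / 2) (by linarith) (by linarith [ht.2]) t (by linarith)

theorem exists_uniformSTLC {n₁ n₂ s₀ : ℝ} (hn₁ : 0 < n₁) (hn₂ : n₁ < n₂) {κ₀ : ℂ}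
    (hκ₀ : κ₀.re ≠ 0) {η : Sphere} (hη : η ∈ regularEquilibria n₁ n₂) :
    ∃ δ : ℝ, 0 < δ ∧ UniformSTLCTo n₁ n₂ s₀ (Metric.ball κ₀ δ) η ∧
      UniformSTLCFrom n₁ n₂ s₀ (Metric.ball κ₀ δ) η := by
  obtain ⟨y, hy, rfl⟩ := hη
  have h : n₁ ^ 2 < y ^ 2 ∧ y ^ 2 < n₂ ^ 2 := by
    rcases hy with ⟨h1, h2⟩ | ⟨h1, h2⟩ <;> constructor <;> nlinarith
  obtain ⟨δ, c, hδ, hc, H⟩ := exists_uniform_local_control (s₀ := s₀) h.1 h.2 hκ₀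
  have h0 : disc ((y : ℂ) : Sphere) 0 = ∅ := by
    ext ξ
    refine ⟨?_, False.elim⟩
    rintro ⟨z, -, hz⟩
    exact (norm_nonneg _).not_gt hz
  refine ⟨δ, hδ, exists_radius_le_rMax hc ?_ h0, exists_radius_le_rMax hc ?_ h0⟩
  · rintro κ hκ T hT hT1 t hTt ξ ⟨z, rfl, hz⟩
    exact mem_biUnion ⟨hT.le, hTt⟩ (H κ hκ T hT hT1 z hz).1
  · rintro κ hκ T hT hT1 t hTt ξ ⟨z, rfl, hz⟩
    exact mem_biUnion (x := T) ⟨hT.le, hTt⟩ (H κ hκ T hT hT1 z hz).2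

end RiccatiControl

theorem theorem4p4 (n₁ n₂ : ℝ) (hn₁ : 0 < n₁) (hn₂ : n₁ < n₂) (s₀ : ℝ)
    (κ₀ : ℂ) (hκ₀ : κ₀.re ≠ 0) (η : RiccatiControl.Sphere) :
    ((∃ δ : ℝ, 0 < δ ∧ RiccatiControl.UniformSTLCTo n₁ n₂ s₀ (Metric.ball κ₀ δ) η) ↔
        η ∈ RiccatiControl.regularEquilibria n₁ n₂) ∧
      ((∃ δ : ℝ, 0 < δ ∧ RiccatiControl.UniformSTLCFrom n₁ n₂ s₀ (Metric.ball κ₀ δ) η) ↔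
        η ∈ RiccatiControl.regularEquilibria n₁ n₂) := by
  have hκ : κ₀ ≠ 0 := fun h => hκ₀ (by simp [h])
  refine ⟨⟨?_, fun h => ?_⟩, ⟨?_, fun h => ?_⟩⟩
  · rintro ⟨δ, hδ, h⟩
    by_contra hη
    exact (RiccatiControl.not_uniformSTLC hn₁ hn₂ hκ hη (Metric.mem_ball_self hδ)).1 h
  · obtain ⟨δ, hδ, h, -⟩ := RiccatiControl.exists_uniformSTLC (s₀ := s₀) hn₁ hn₂ hκ₀ h
    exact ⟨δ, hδ, h⟩
  · rintro ⟨δ, hδ, h⟩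
    by_contra hη
    exact (RiccatiControl.not_uniformSTLC hn₁ hn₂ hκ hη (Metric.mem_ball_self hδ)).2 h
  · obtain ⟨δ, hδ, -, h⟩ := RiccatiControl.exists_uniformSTLC (s₀ := s₀) hn₁ hn₂ hκ₀ h
    exact ⟨δ, hδ, h⟩
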